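/- **Conventions.** All limits are bicategorical. Let $\mathcal J$ be a small bicategory, $W:\mathcal J\to \mathrm{Cat}$ a pseudofunctor to small categories (the weight) and $D:\mathcal J\to\mathcal B$ a pseudofunctor to a bicategory. A *$W$-weighted cone* over $D$ with vertex $x$ is a pseudonatural transformation $W\Rightarrow\mathcal B(x,D-)$; with modifications as morphisms these form a category $\mathrm{Cone}_W(x,D)$. A cone $\kappa$ with vertex $x$ is a *$W$-weighted limit* of $D$ if for every object $y$ of $\mathcal B$ the restriction functor $\mathcal B(y,x)\to\mathrm{Cone}_W(y,D)$, $f\mapsto \kappa f$, is an equivalence of categories. For a small category $A$ write $\hat A=[A^{op},\mathrm{Set}]$ and $y_A:A\to\hat A$ for the Yoneda embedding. For a functor $I:A\to E$ with $E$ locally small, its *nerve* is $N_I:E\to\hat A$, $e\mapsto E(I-,e)$. * $\mathrm{CAT}$: locally small categories, functors, natural transformations. * $\mathrm{Prof}$: small categories; a 1-cell $A\to B$ is a cocontinuous functor $\hat A\to\hat B$; 2-cells are natural transformations. * $\mathrm{CAT}^{\mathbf 2}$: objects are functors between locally small categories; 1-cells are squares commuting up to a specified isomorphism; 2-cells are pairs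 of natural transformations compatible with these isomorphisms. * $\mathrm{CwA}$ (categories with arities): a 0-cell is $(A,E,I)$ with $A$ small, $E$ locally small and $I:A\to E$ fully faithful and dense. A 1-cell $(A,E,I)\to(B,F,J)$ is a functor $K:E\to F$ that respects arities: for $\bar K=\mathrm{Lan}_{y_A}(N_J K I):\hat A\to\hat B$, there is a natural isomorphism $\bar K N_I\cong N_J K$. 2-cells are all natural transformations. There are pseudofunctors $\mathrm{CwA}\to\mathrm{Prof}$, $(A,E,I)\mapsto A$, $K\mapsto\bar K$; $\mathrm{CwA}\to\mathrm{CAT}$, $(A,E,I)\mapsto E$; and $\mathrm{CwA}\to\mathrm{CAT}^{\mathbf 2}$, $(A,E,I)\mapsto N_I$. **Theorem.** Let $D:\mathcal J\to\mathrm{CwA}$, $j\mapsto(A_j,E_j,I_j)$, be a pseudofunctor and $W:\mathcal J\to\mathrm{Cat}$ a weight. Suppose that 1. the $W$-weighted limit of $j\mapsto A_j$ exists in $\mathrm{Prof}$, with vertex a small category $A$; and 2. the $W$-weighted limit of $j\mapsto N_{I_j}$ in $\mathrm{CAT}^{\mathbf 2}$ is induced by a full subcategory: there are a locally small category $E$ and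 a fully faithful functor $I:A\to E$ such that $N_I:E\to\hat A$ is the vertex of a $W$-weighted limit cone $\nu$ of $j\mapsto N_{I_j}$ in $\mathrm{CAT}^{\mathbf 2}$. Then $I$ is dense, so that $(A,E,I)$ is an object of $\mathrm{CwA}$, and it is the vertex of a cone $\kappa$ over $D$ that is a $W$-weighted limit of $D$ in $\mathrm{CwA}$. Moreover the image of $\kappa$ in $\mathrm{CAT}^{\mathbf 2}$ is isomorphic to $\nu$, and the images of $\kappa$ in $\mathrm{Prof}$ and in $\mathrm{CAT}$ are $W$-weighted limits. Thus $\lim^W D=(\lim^W_{\mathrm{Prof}}A_j,\ \lim^W_{\mathrm{CAT}}E_j,\ I)$. -/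

import Mathlib

open CategoryTheory Bicategory

universe u

namespace WeightedLimits

universe w v w₁ v₁ u₁ w₂ v₂ u₂ w₃ v₃ u₃

variable {J : Type u₁} [Bicategory.{w₁, v₁} J] {B : Type u₂} [Bicategory.{w₂, v₂} B]
  {C : Type u₃} [Bicategory.{w₃, v₃} C]

/-- A `W`-weighted cone over `D` with vertex `x`: a pseudonatural transformation from the weight
`W` to the `Cat`-valued pseudofunctor `j ↦ (x ⟶ D j)`, written out in components. -/
structure WeightedCone (W : J ⥤ᵖ Cat.{w, v}) (D : J ⥤ᵖ B) (x : B) where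
  leg (j : J) : W.obj j ⥤ (x ⟶ D.obj j)
  square {i j : J} (f : i ⟶ j) (a : W.obj i) :
    (leg i).obj a ≫ D.map f ≅ (leg j).obj ((W.map f).toFunctor.obj a)
  square_natural {i j : J} (f : i ⟶ j) {a b : W.obj i} (t : a ⟶ b) :
    (leg i).map t ▷ D.map f ≫ (square f b).hom =
      (square f a).hom ≫ (leg j).map ((W.map f).toFunctor.map t)
  square_map₂ {i j : J} {f g : i ⟶ j} (θ : f ⟶ g) (a : W.obj i) :
    (leg i).obj a ◁ D.map₂ θ ≫ (square g a).hom =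
      (square f a).hom ≫ (leg j).map ((W.map₂ θ).toNatTrans.app a)
  square_id (i : J) (a : W.obj i) :
    (square (𝟙 i) a).hom ≫ (leg i).map ((W.mapId i).hom.toNatTrans.app a) =
      (leg i).obj a ◁ (D.mapId i).hom ≫ (ρ_ ((leg i).obj a)).hom
  square_comp {i j k : J} (f : i ⟶ j) (g : j ⟶ k) (a : W.obj i) :
    (square (f ≫ g) a).hom ≫ (leg k).map ((W.mapComp f g).hom.toNatTrans.app a) =
      (leg i).obj a ◁ (D.mapComp f g).hom ≫
        (α_ ((leg i).obj a) (D.map f) (D.map g)).inv ≫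
          (square f a).hom ▷ D.map g ≫ (square g ((W.map f).toFunctor.obj a)).hom

namespace WeightedCone

variable {W : J ⥤ᵖ Cat.{w, v}} {D : J ⥤ᵖ B} {x : B}

/-- A morphism of weighted cones with the same vertex: a modification. -/
@[ext]
structure Hom (κ κ' : WeightedCone W D x) where
  app (j : J) : κ.leg j ⟶ κ'.leg j
  comm {i j : J} (f : i ⟶ j) (a : W.obj i) :
    (κ.square f a).hom ≫ (app j).app ((W.map f).toFunctor.obj a) =
      (app i).app a ▷ D.map f ≫ (κ'.square f a).hom

instance : Category (WeightedCone W D x) where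
  Hom := Hom
  id κ := { app := fun j => 𝟙 _, comm := by intros; simp }
  comp {κ κ' κ''} m n :=
    { app := fun j => m.app j ≫ n.app j
      comm := by
        intro i j f a
        have h₁ := m.comm f a
        have h₂ := n.comm f a
        simp only [NatTrans.comp_app, comp_whiskerRight, Category.assoc]
        rw [reassoc_of% h₁, h₂] }
  id_comp m := by apply Hom.ext; funext j; exact Category.id_comp _
  comp_id m := by apply Hom.ext; funext j; exact Category.comp_id _
  assoc m n p := by apply Hom.ext; funext j; exact Category.assoc _ _ _

/-- Restriction of a weighted cone with vertex `x` along a 1-cell `g : y ⟶ x`. -/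
def restrict (κ : WeightedCone W D x) {y : B} (g : y ⟶ x) : WeightedCone W D y where
  leg j := κ.leg j ⋙ precomp (D.obj j) g
  square {i j} f a := α_ g ((κ.leg i).obj a) (D.map f) ≪≫ whiskerLeftIso g (κ.square f a)
  square_natural {i j} f a b t := by
    have h := κ.square_natural f t
    change (g ◁ _) ▷ _ ≫ (α_ _ _ _).hom ≫ g ◁ _ = ((α_ _ _ _).hom ≫ g ◁ _) ≫ g ◁ _
    simp only [Category.assoc, ← Bicategory.whiskerLeft_comp, ← h]
    simp
  square_map₂ {i j f f'} θ a := by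
    have h := κ.square_map₂ θ a
    change (g ≫ _) ◁ _ ≫ (α_ _ _ _).hom ≫ g ◁ _ = ((α_ _ _ _).hom ≫ g ◁ _) ≫ g ◁ _
    simp only [Category.assoc, ← Bicategory.whiskerLeft_comp, ← h]
    simp
  square_id i a := by
    have h := κ.square_id i a
    change ((α_ _ _ _).hom ≫ g ◁ _) ≫ g ◁ _ = (g ≫ _) ◁ _ ≫ (ρ_ (g ≫ _)).hom
    simp only [Category.assoc, ← Bicategory.whiskerLeft_comp, h]
    simp
  square_comp {i j k} f f' a := by
    have h := κ.square_comp f f' a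
    change ((α_ _ _ _).hom ≫ g ◁ _) ≫ g ◁ _ = (g ≫ _) ◁ _ ≫ (α_ (g ≫ _) _ _).inv ≫
      ((α_ _ _ _).hom ≫ g ◁ _) ▷ _ ≫ (α_ _ _ _).hom ≫ g ◁ _
    simp only [Category.assoc, ← Bicategory.whiskerLeft_comp, h]
    simp

/-- Restriction along 1-cells `y ⟶ x` and 2-cells between them, as a functor. -/
def restriction (κ : WeightedCone W D x) (y : B) : (y ⟶ x) ⥤ WeightedCone W D y where
  obj g := κ.restrict g
  map {g g'} β :=
    { app := fun j => { app := fun a => β ▷ (κ.leg j).obj a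
                        naturality := fun a b t => (whisker_exchange β ((κ.leg j).map t)) }
      comm := by
        intro i j f a
        change ((α_ _ _ _).hom ≫ g ◁ _) ≫ β ▷ _ = (β ▷ _) ▷ _ ≫ (α_ _ _ _).hom ≫ g' ◁ _
        simp [whisker_exchange] }
  map_id g := by apply Hom.ext; funext j; ext a; exact id_whiskerRight _ _
  map_comp β γ := by apply Hom.ext; funext j; ext a; exact comp_whiskerRight _ _ _

/-- The cone `κ` exhibits its vertex as a `W`-weighted limit of `D`: for all `y`, restriction is an
equivalence from the category of 1-cells `y ⟶ x` to the category of `W`-weighted cones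
with vertex `y`. -/
def IsLimit (κ : WeightedCone W D x) : Prop :=
  ∀ y : B, (κ.restriction y).IsEquivalence

/-- The image of a weighted cone under a pseudofunctor. -/
def map (κ : WeightedCone W D x) (F : B ⥤ᵖ C) : WeightedCone W (D.comp F) (F.obj x) where
  leg j := κ.leg j ⋙ F.mapFunctor x (D.obj j)
  square {i j} f a :=
    (F.mapComp ((κ.leg i).obj a) (D.map f)).symm ≪≫ F.map₂Iso (κ.square f a)
  square_natural {i j} f a b t := by
    have h := κ.square_natural f t
    change F.map₂ _ ▷ F.map _ ≫ _ ≫ _ = (_ ≫ F.map₂ _) ≫ F.map₂ _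
    simp only [Category.assoc, ← PrelaxFunctor.map₂_comp, ← h]
    simp
  square_map₂ {i j f f'} θ a := by
    have h := κ.square_map₂ θ a
    change F.map _ ◁ F.map₂ _ ≫ _ ≫ _ = (_ ≫ F.map₂ _) ≫ F.map₂ _
    simp only [Category.assoc, ← PrelaxFunctor.map₂_comp, ← h]
    simp
  square_id i a := by
    have h := κ.square_id i a
    change (_ ≫ F.map₂ _) ≫ F.map₂ _ = F.map _ ◁ (F.map₂ _ ≫ (F.mapId _).hom) ≫ (ρ_ (F.map _)).hom
    simp only [Category.assoc, ← PrelaxFunctor.map₂_comp, h]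
    simp
  square_comp {i j k} f f' a := by
    have h := κ.square_comp f f' a
    change (_ ≫ F.map₂ _) ≫ F.map₂ _ = F.map _ ◁ (F.map₂ _ ≫ (F.mapComp _ _).hom) ≫
      (α_ (F.map _) (F.map _) (F.map _)).inv ≫ (_ ≫ F.map₂ _) ▷ F.map _ ≫ (_ ≫ F.map₂ _)
    have h' : F.map₂ (α_ ((κ.leg i).obj a) (D.map f) (D.map f')).inv ≫
        (F.mapComp ((κ.leg i).obj a ≫ D.map f) (D.map f')).hom =
        (F.mapComp ((κ.leg i).obj a) (D.map f ≫ D.map f')).hom ≫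
          F.map ((κ.leg i).obj a) ◁ (F.mapComp (D.map f) (D.map f')).hom ≫
            (α_ _ _ _).inv ≫ (F.mapComp ((κ.leg i).obj a) (D.map f)).inv ▷ F.map (D.map f') := by
      rw [F.mapComp_assoc_right_hom_assoc]
      simp
    simp only [Category.assoc, ← PrelaxFunctor.map₂_comp, h]
    simp [reassoc_of% h']

end WeightedCone
end WeightedLimits

namespace Arities

open Limits

/-- The category of presheaves of sets on a small category. -/
abbrev Psh (A : Type u) [SmallCategory A] : Type (u + 1) := Aᵒᵖ ⥤ Type u

/-- The nerve `e ↦ E(I -, e)` of a functor `I` from a small category to a locally small one. -/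
def nerve {A : Type u} [SmallCategory A] {E : Type (u + 1)} [LargeCategory.{u} E] (I : A ⥤ E) :
    E ⥤ Psh A :=
  CategoryTheory.yoneda ⋙ (Functor.whiskeringLeft Aᵒᵖ Eᵒᵖ (Type u)).obj I.op

/-! ### The bicategory of small categories and cocontinuous functors between presheaf categories -/

/-- An object of `Prof` is a small category. -/
structure Prof where
  carrier : Type u
  [cat : SmallCategory carrier]

namespace Prof

attribute [instance] Prof.cat

/-- A 1-cell `A ⟶ B` of `Prof` is a cocontinuous functor between the presheaf categories. -/
structure Hom (A B : Prof.{u}) where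
  functor : Psh A.carrier ⥤ Psh B.carrier
  cocontinuous : PreservesColimitsOfSize.{u, u} functor

/-- A 2-cell of `Prof` is a natural transformation. -/
@[ext]
structure Hom₂ {A B : Prof.{u}} (P Q : Hom A B) where
  natTrans : P.functor ⟶ Q.functor

instance {A B : Prof.{u}} : Category (Hom A B) where
  Hom P Q := Hom₂ P Q
  id P := ⟨𝟙 P.functor⟩
  comp α β := ⟨α.natTrans ≫ β.natTrans⟩
  id_comp _ := Hom₂.ext (Category.id_comp _)
  comp_id _ := Hom₂.ext (Category.comp_id _)
  assoc _ _ _ := Hom₂.ext (Category.assoc _ _ _)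

/-- An invertible 2-cell of `Prof` from a natural isomorphism. -/
def isoMk {A B : Prof.{u}} {P Q : Hom A B} (e : P.functor ≅ Q.functor) : P ≅ Q where
  hom := ⟨e.hom⟩
  inv := ⟨e.inv⟩
  hom_inv_id := Hom₂.ext e.hom_inv_id
  inv_hom_id := Hom₂.ext e.inv_hom_id

/-- `Prof` with composition of functors. -/
instance : Bicategory Prof.{u} where
  Hom A B := Hom A B
  id A := ⟨𝟭 _, inferInstance⟩
  comp P Q := ⟨P.functor ⋙ Q.functor, by
    have := P.cocontinuous
    have := Q.cocontinuous
    infer_instance⟩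
  homCategory A B := inferInstance
  whiskerLeft P _ _ β := ⟨Functor.whiskerLeft P.functor β.natTrans⟩
  whiskerRight α Q := ⟨Functor.whiskerRight α.natTrans Q.functor⟩
  associator P Q R := isoMk (Functor.associator P.functor Q.functor R.functor)
  leftUnitor P := isoMk (Functor.leftUnitor P.functor)
  rightUnitor P := isoMk (Functor.rightUnitor P.functor)
  whiskerLeft_id _ _ := Hom₂.ext (Functor.whiskerLeft_id' _)
  whiskerLeft_comp _ _ _ _ _ _ := Hom₂.ext (Functor.whiskerLeft_comp _ _ _)
  id_whiskerLeft _ := Hom₂.ext (NatTrans.ext (funext fun _ => ((Category.id_comp _).trans (Category.comp_id _)).symm))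
  comp_whiskerLeft _ _ _ _ _ :=
    Hom₂.ext (NatTrans.ext (funext fun _ => ((Category.id_comp _).trans (Category.comp_id _)).symm))
  id_whiskerRight _ _ := Hom₂.ext (Functor.whiskerRight_id' _)
  comp_whiskerRight _ _ _ := Hom₂.ext (Functor.whiskerRight_comp _ _ _)
  whiskerRight_id _ := Hom₂.ext (NatTrans.ext (funext fun _ => ((Category.id_comp _).trans (Category.comp_id _)).symm))
  whiskerRight_comp _ _ _ :=
    Hom₂.ext (NatTrans.ext (funext fun _ => ((Category.id_comp _).trans (Category.comp_id _)).symm))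
  whisker_assoc _ _ _ _ _ :=
    Hom₂.ext (NatTrans.ext (funext fun _ => ((Category.id_comp _).trans (Category.comp_id _)).symm))
  whisker_exchange α β := Hom₂.ext (by
    ext x : 2
    exact (β.natTrans.naturality (α.natTrans.app x)).symm)
  pentagon P Q R S := Hom₂.ext (Functor.pentagon P.functor Q.functor R.functor S.functor)
  triangle P Q := Hom₂.ext (Functor.triangle P.functor Q.functor)

end Prof

/-! ### The bicategory of arrows of `CAT` and pseudo-commuting squares -/

/-- An object of `CAT^2` is a functor between locally small categories. -/
structure ArrCAT where
  dom : Type (u + 1)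
  cod : Type (u + 1)
  [catDom : LargeCategory.{u} dom]
  [catCod : LargeCategory.{u} cod]
  functor : dom ⥤ cod

namespace ArrCAT

attribute [instance] ArrCAT.catDom ArrCAT.catCod

/-- A 1-cell of `CAT^2` is a pseudo-commuting square. -/
structure Hom (X Y : ArrCAT.{u}) where
  top : X.dom ⥤ Y.dom
  bot : X.cod ⥤ Y.cod
  square (e : X.dom) : bot.obj (X.functor.obj e) ≅ Y.functor.obj (top.obj e)
  square_natural {e e' : X.dom} (f : e ⟶ e') :
    bot.map (X.functor.map f) ≫ (square e').hom =
      (square e).hom ≫ Y.functor.map (top.map f)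

/-- A 2-cell of `CAT^2` is a pair of natural transformations compatible with the squares. -/
@[ext]
structure Hom₂ {X Y : ArrCAT.{u}} (F G : Hom X Y) where
  top : F.top ⟶ G.top
  bot : F.bot ⟶ G.bot
  comm (e : X.dom) : (F.square e).hom ≫ Y.functor.map (top.app e) =
    bot.app (X.functor.obj e) ≫ (G.square e).hom

instance {X Y : ArrCAT.{u}} : Category (Hom X Y) where
  Hom F G := Hom₂ F G
  id F := ⟨𝟙 _, 𝟙 _, fun e => by simp⟩
  comp α β := ⟨α.top ≫ β.top, α.bot ≫ β.bot, fun e => by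
    have h₁ := α.comm e
    have h₂ := β.comm e
    simp only [NatTrans.comp_app, Functor.map_comp, Category.assoc]
    rw [reassoc_of% h₁, h₂]⟩
  id_comp _ := Hom₂.ext (Category.id_comp _) (Category.id_comp _)
  comp_id _ := Hom₂.ext (Category.comp_id _) (Category.comp_id _)
  assoc _ _ _ := Hom₂.ext (Category.assoc _ _ _) (Category.assoc _ _ _)

/-- An invertible 2-cell of `CAT^2` from compatible natural isomorphisms. -/
def isoMk {X Y : ArrCAT.{u}} {F G : Hom X Y} (t : F.top ≅ G.top) (b : F.bot ≅ G.bot)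
    (h : ∀ e : X.dom, (F.square e).hom ≫ Y.functor.map (t.hom.app e) =
      b.hom.app (X.functor.obj e) ≫ (G.square e).hom) : F ≅ G where
  hom := ⟨t.hom, b.hom, h⟩
  inv := ⟨t.inv, b.inv, fun e => by
    have h₁ := congrArg (fun k => b.inv.app _ ≫ k ≫ Y.functor.map (t.inv.app e)) (h e)
    simpa [← Functor.map_comp] using h₁.symm⟩
  hom_inv_id := Hom₂.ext t.hom_inv_id b.hom_inv_id
  inv_hom_id := Hom₂.ext t.inv_hom_id b.inv_hom_id

/-- Identity pseudo-commuting square. -/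
def Hom.id (X : ArrCAT.{u}) : Hom X X where
  top := 𝟭 _
  bot := 𝟭 _
  square _ := Iso.refl _
  square_natural _ := (Category.comp_id _).trans (Category.id_comp _).symm

/-- Pasting of pseudo-commuting squares. -/
def Hom.comp {X Y Z : ArrCAT.{u}} (F : Hom X Y) (G : Hom Y Z) : Hom X Z where
  top := F.top ⋙ G.top
  bot := F.bot ⋙ G.bot
  square e := G.bot.mapIso (F.square e) ≪≫ G.square (F.top.obj e)
  square_natural {e e'} f := by
    have h₁ := F.square_natural f
    have h₂ := G.square_natural (F.top.map f)
    change G.bot.map (F.bot.map _) ≫ G.bot.map _ ≫ _ = (G.bot.map _ ≫ _) ≫ _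
    rw [← Functor.map_comp_assoc, h₁, Functor.map_comp_assoc, h₂, Category.assoc]
    rfl

instance : Bicategory ArrCAT.{u} where
  Hom X Y := Hom X Y
  id X := Hom.id X
  comp F G := Hom.comp F G
  homCategory X Y := inferInstance
  whiskerLeft {X Y Z} F G H β := ⟨Functor.whiskerLeft F.top β.top, Functor.whiskerLeft F.bot β.bot, fun e => by
    have h := β.comm (F.top.obj e)
    change (G.bot.map _ ≫ _) ≫ Z.functor.map (β.top.app _) = β.bot.app _ ≫ H.bot.map _ ≫ _
    rw [Category.assoc, h, ← NatTrans.naturality_assoc]⟩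
  whiskerRight {X Y Z} F G α H := ⟨Functor.whiskerRight α.top H.top, Functor.whiskerRight α.bot H.bot, fun e => by
    have h₁ := α.comm e
    have h₂ := H.square_natural (α.top.app e)
    change (H.bot.map _ ≫ _) ≫ Z.functor.map (H.top.map (α.top.app _)) =
      H.bot.map (α.bot.app _) ≫ H.bot.map _ ≫ _
    rw [Category.assoc, ← h₂, ← Functor.map_comp_assoc, h₁, Functor.map_comp_assoc]⟩
  associator {W X Y Z} F G H := isoMk (Functor.associator F.top G.top H.top)
    (Functor.associator F.bot G.bot H.bot) (fun e => by
      change (H.bot.map (G.bot.map (F.square e).hom ≫ (G.square (F.top.obj e)).hom) ≫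
          (H.square (G.top.obj (F.top.obj e))).hom) ≫
            Z.functor.map (𝟙 (H.top.obj (G.top.obj (F.top.obj e)))) =
        𝟙 (H.bot.obj (G.bot.obj (F.bot.obj (W.functor.obj e)))) ≫
          H.bot.map (G.bot.map (F.square e).hom) ≫ H.bot.map (G.square (F.top.obj e)).hom ≫
            (H.square (G.top.obj (F.top.obj e))).hom
      simp)
  leftUnitor {X Y} F := isoMk (Functor.leftUnitor F.top) (Functor.leftUnitor F.bot) (fun e => by
      change (F.bot.map (𝟙 _) ≫ (F.square e).hom) ≫ Y.functor.map (𝟙 _) = 𝟙 _ ≫ (F.square e).hom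
      simp)
  rightUnitor {X Y} F := isoMk (Functor.rightUnitor F.top) (Functor.rightUnitor F.bot) (fun e => by
      change ((F.square e).hom ≫ 𝟙 _) ≫ Y.functor.map (𝟙 _) = 𝟙 _ ≫ (F.square e).hom
      simp)
  whiskerLeft_id _ _ := Hom₂.ext (Functor.whiskerLeft_id' _) (Functor.whiskerLeft_id' _)
  whiskerLeft_comp _ _ _ _ _ _ :=
    Hom₂.ext (Functor.whiskerLeft_comp _ _ _) (Functor.whiskerLeft_comp _ _ _)
  id_whiskerLeft _ := Hom₂.ext
    (NatTrans.ext (funext fun _ => ((Category.id_comp _).trans (Category.comp_id _)).symm))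
    (NatTrans.ext (funext fun _ => ((Category.id_comp _).trans (Category.comp_id _)).symm))
  comp_whiskerLeft _ _ _ _ _ := Hom₂.ext
    (NatTrans.ext (funext fun _ => ((Category.id_comp _).trans (Category.comp_id _)).symm))
    (NatTrans.ext (funext fun _ => ((Category.id_comp _).trans (Category.comp_id _)).symm))
  id_whiskerRight _ _ := Hom₂.ext (Functor.whiskerRight_id' _) (Functor.whiskerRight_id' _)
  comp_whiskerRight _ _ _ :=
    Hom₂.ext (Functor.whiskerRight_comp _ _ _) (Functor.whiskerRight_comp _ _ _)
  whiskerRight_id _ := Hom₂.ext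
    (NatTrans.ext (funext fun _ => ((Category.id_comp _).trans (Category.comp_id _)).symm))
    (NatTrans.ext (funext fun _ => ((Category.id_comp _).trans (Category.comp_id _)).symm))
  whiskerRight_comp _ _ _ := Hom₂.ext
    (NatTrans.ext (funext fun _ => ((Category.id_comp _).trans (Category.comp_id _)).symm))
    (NatTrans.ext (funext fun _ => ((Category.id_comp _).trans (Category.comp_id _)).symm))
  whisker_assoc _ _ _ _ _ := Hom₂.ext
    (NatTrans.ext (funext fun _ => ((Category.id_comp _).trans (Category.comp_id _)).symm))
    (NatTrans.ext (funext fun _ => ((Category.id_comp _).trans (Category.comp_id _)).symm))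
  whisker_exchange α β := Hom₂.ext
    (by ext x : 2; exact (β.top.naturality (α.top.app x)).symm)
    (by ext x : 2; exact (β.bot.naturality (α.bot.app x)).symm)
  pentagon P Q R S := Hom₂.ext (Functor.pentagon P.top Q.top R.top S.top)
    (Functor.pentagon P.bot Q.bot R.bot S.bot)
  triangle P Q := Hom₂.ext (Functor.triangle P.top Q.top) (Functor.triangle P.bot Q.bot)

end ArrCAT

section Yoneda

variable {A : Type u} [SmallCategory A] {D : Type (u + 1)} [LargeCategory.{u} D]

/-- A cocontinuous functor on presheaves is the left Kan extension of its restriction along the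
Yoneda embedding. -/
theorem isLeftKanExtension_of_cocontinuous (P : Psh A ⥤ D) [PreservesColimitsOfSize.{u, u} P]
    {H : A ⥤ D} (e : H ≅ CategoryTheory.yoneda ⋙ P) : P.IsLeftKanExtension e.hom := by
  apply Functor.LeftExtension.IsPointwiseLeftKanExtension.isLeftKanExtension
    (E := Functor.LeftExtension.mk P e.hom)
  intro X
  have h := isColimitOfPreserves P (Presheaf.isColimitTautologicalCocone X)
  let e' : CostructuredArrow.proj CategoryTheory.yoneda X ⋙ H ≅ (CostructuredArrow.proj CategoryTheory.yoneda X ⋙ CategoryTheory.yoneda) ⋙ P :=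
    Functor.isoWhiskerLeft (CostructuredArrow.proj CategoryTheory.yoneda X) e
  exact ((IsColimit.precomposeHomEquiv e' _).symm h).ofIsoColimit (Cocone.ext (Iso.refl _) (fun j => by
    exact Category.comp_id _))

theorem yoneda_leftKanExtension_cocontinuous {B : Type u} [SmallCategory B] (H : A ⥤ Psh B) :
    PreservesColimitsOfSize.{u, u} (CategoryTheory.yoneda.leftKanExtension H) := by
  let L : Psh A ⥤ Psh B := (uliftYoneda.{u} : A ⥤ Psh A).leftKanExtension H
  have hL : PreservesColimitsOfSize.{u, u} L :=
    Presheaf.preservesColimitsOfSize_leftKanExtension.{u} H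
  let e : H ≅ CategoryTheory.yoneda ⋙ L := (Presheaf.isExtensionAlongULiftYoneda.{u} H).symm ≪≫
    Functor.isoWhiskerRight uliftYonedaIsoYoneda.{u} L
  have := isLeftKanExtension_of_cocontinuous L e
  exact preservesColimits_of_natIso (Functor.leftKanExtensionUnique L e.hom
    (CategoryTheory.yoneda.leftKanExtension H) (CategoryTheory.yoneda.leftKanExtensionUnit H))

end Yoneda
/-! ### The 2-category of categories with arities -/

/-- A category with arities: a locally small category `E` with a small dense full subcategory
`incl : A ⥤ E`. -/
structure CwA where
  A : Type u
  E : Type (u + 1)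
  [catA : SmallCategory A]
  [catE : LargeCategory.{u} E]
  incl : A ⥤ E
  [full : incl.Full]
  [faithful : incl.Faithful]
  [dense : incl.IsDense]

namespace CwA

attribute [instance] CwA.catA CwA.catE CwA.full CwA.faithful CwA.dense

/-- The left Kan extension of `N_Y ∘ K ∘ I_X` along the Yoneda embedding. -/
noncomputable def extension {X Y : CwA.{u}} (K : X.E ⥤ Y.E) : Psh X.A ⥤ Psh Y.A :=
  CategoryTheory.yoneda.leftKanExtension (X.incl ⋙ K ⋙ nerve Y.incl)

/-- `K` respects arities if the square of nerves pseudo-commutes: `N_Y ∘ K` is isomorphic to `extension K ∘ N_X`. -/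
def RespectsArities {X Y : CwA.{u}} (K : X.E ⥤ Y.E) : Prop :=
  Nonempty (nerve X.incl ⋙ extension K ≅ K ⋙ nerve Y.incl)



theorem extension_cocontinuous {X Y : CwA.{u}} (K : X.E ⥤ Y.E) :
    PreservesColimitsOfSize.{u, u} (extension K) :=
  yoneda_leftKanExtension_cocontinuous _

/-- As `I` is fully faithful, the nerve of `I a` is the presheaf represented by `a`. -/
noncomputable def rep (X : CwA.{u}) (a : X.A) :
    CategoryTheory.yoneda.obj a ≅ (nerve X.incl).obj (X.incl.obj a) :=
  NatIso.ofComponents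
    (fun b => (Functor.FullyFaithful.ofFullyFaithful X.incl).homEquiv.toIso)
    (by
      intro b b' f
      ext g
      exact X.incl.map_comp f.unop g)

theorem rep_natural (X : CwA.{u}) {a a' : X.A} (f : a ⟶ a') :
    CategoryTheory.yoneda.map f ≫ (X.rep a').hom =
      (X.rep a).hom ≫ (nerve X.incl).map (X.incl.map f) := by
  ext b g
  exact X.incl.map_comp g f

theorem extension_unique {X Y : CwA.{u}} (K : X.E ⥤ Y.E) (P : Psh X.A ⥤ Psh Y.A)
    [PreservesColimitsOfSize.{u, u} P] (e : nerve X.incl ⋙ P ≅ K ⋙ nerve Y.incl) :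
    Nonempty (extension K ≅ P) := by
  let e' : X.incl ⋙ K ⋙ nerve Y.incl ≅ CategoryTheory.yoneda ⋙ P :=
    Functor.isoWhiskerLeft X.incl e.symm ≪≫ Functor.isoWhiskerRight
      (NatIso.ofComponents X.rep (fun f => X.rep_natural f) :
        CategoryTheory.yoneda ≅ X.incl ⋙ nerve X.incl).symm P
  have := isLeftKanExtension_of_cocontinuous P e'
  exact ⟨Functor.leftKanExtensionUnique
    (CategoryTheory.yoneda.leftKanExtension (X.incl ⋙ K ⋙ nerve Y.incl))
    (CategoryTheory.yoneda.leftKanExtensionUnit (X.incl ⋙ K ⋙ nerve Y.incl)) P e'.hom⟩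

theorem respectsArities_of_square {X Y : CwA.{u}} (K : X.E ⥤ Y.E) (P : Psh X.A ⥤ Psh Y.A)
    [PreservesColimitsOfSize.{u, u} P] (e : nerve X.incl ⋙ P ≅ K ⋙ nerve Y.incl) :
    RespectsArities K := by
  obtain ⟨i⟩ := extension_unique K P e
  exact ⟨Functor.isoWhiskerLeft _ i ≪≫ e⟩

theorem respectsArities_id (X : CwA.{u}) : RespectsArities (𝟭 X.E) :=
  respectsArities_of_square _ (𝟭 _) (Iso.refl _)

theorem RespectsArities.comp {X Y Z : CwA.{u}} {K : X.E ⥤ Y.E} {L : Y.E ⥤ Z.E}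
    (hK : RespectsArities K) (hL : RespectsArities L) : RespectsArities (K ⋙ L) := by
  obtain ⟨i⟩ := hK
  obtain ⟨j⟩ := hL
  have := extension_cocontinuous K
  have := extension_cocontinuous L
  exact respectsArities_of_square _ (extension K ⋙ extension L)
    (Functor.isoWhiskerRight i (extension L) ≪≫ Functor.isoWhiskerLeft K j)

/-- A 1-cell of `CwA` is an arities-respecting functor. -/
structure Hom (X Y : CwA.{u}) where
  functor : X.E ⥤ Y.E
  respects : RespectsArities functor

/-- A 2-cell of `CwA` is an arbitrary natural transformation. -/
@[ext]
structure Hom₂ {X Y : CwA.{u}} (K L : Hom X Y) where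
  natTrans : K.functor ⟶ L.functor

instance {X Y : CwA.{u}} : Category (Hom X Y) where
  Hom P Q := Hom₂ P Q
  id P := ⟨𝟙 P.functor⟩
  comp α β := ⟨α.natTrans ≫ β.natTrans⟩
  id_comp _ := Hom₂.ext (Category.id_comp _)
  comp_id _ := Hom₂.ext (Category.comp_id _)
  assoc _ _ _ := Hom₂.ext (Category.assoc _ _ _)

/-- An invertible 2-cell of `CwA` from a natural isomorphism. -/
def isoMk {A B : CwA.{u}} {P Q : Hom A B} (e : P.functor ≅ Q.functor) : P ≅ Q where
  hom := ⟨e.hom⟩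
  inv := ⟨e.inv⟩
  hom_inv_id := Hom₂.ext e.hom_inv_id
  inv_hom_id := Hom₂.ext e.inv_hom_id

instance : Bicategory CwA.{u} where
  Hom A B := Hom A B
  id A := ⟨𝟭 _, respectsArities_id A⟩
  comp P Q := ⟨P.functor ⋙ Q.functor, P.respects.comp Q.respects⟩
  homCategory A B := inferInstance
  whiskerLeft P _ _ β := ⟨Functor.whiskerLeft P.functor β.natTrans⟩
  whiskerRight α Q := ⟨Functor.whiskerRight α.natTrans Q.functor⟩
  associator P Q R := isoMk (Functor.associator P.functor Q.functor R.functor)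
  leftUnitor P := isoMk (Functor.leftUnitor P.functor)
  rightUnitor P := isoMk (Functor.rightUnitor P.functor)
  whiskerLeft_id _ _ := Hom₂.ext (Functor.whiskerLeft_id' _)
  whiskerLeft_comp _ _ _ _ _ _ := Hom₂.ext (Functor.whiskerLeft_comp _ _ _)
  id_whiskerLeft _ := Hom₂.ext (NatTrans.ext (funext fun _ => ((Category.id_comp _).trans (Category.comp_id _)).symm))
  comp_whiskerLeft _ _ _ _ _ :=
    Hom₂.ext (NatTrans.ext (funext fun _ => ((Category.id_comp _).trans (Category.comp_id _)).symm))
  id_whiskerRight _ _ := Hom₂.ext (Functor.whiskerRight_id' _)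
  comp_whiskerRight _ _ _ := Hom₂.ext (Functor.whiskerRight_comp _ _ _)
  whiskerRight_id _ := Hom₂.ext (NatTrans.ext (funext fun _ => ((Category.id_comp _).trans (Category.comp_id _)).symm))
  whiskerRight_comp _ _ _ :=
    Hom₂.ext (NatTrans.ext (funext fun _ => ((Category.id_comp _).trans (Category.comp_id _)).symm))
  whisker_assoc _ _ _ _ _ :=
    Hom₂.ext (NatTrans.ext (funext fun _ => ((Category.id_comp _).trans (Category.comp_id _)).symm))
  whisker_exchange α β := Hom₂.ext (by
    ext x : 2
    exact (β.natTrans.naturality (α.natTrans.app x)).symm)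
  pentagon P Q R S := Hom₂.ext (Functor.pentagon P.functor Q.functor R.functor S.functor)
  triangle P Q := Hom₂.ext (Functor.triangle P.functor Q.functor)

/-- The forgetful pseudofunctor `(A, E, I) ↦ E`. -/
def toCAT : CwA.{u} ⥤ᵖ Cat.{u, u + 1} where
  obj X := Cat.of X.E
  map K := K.functor.toCatHom
  map₂ α := α.natTrans.toCatHom₂
  map₂_id _ := rfl
  map₂_comp _ _ := rfl
  mapId _ := Iso.refl _
  mapComp _ _ := Iso.refl _
  map₂_whisker_left _ _ _ _ := by
    ext x; exact ((Category.id_comp _).trans (Category.comp_id _)).symm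
  map₂_whisker_right _ _ := by
    ext x; exact ((Category.id_comp _).trans (Category.comp_id _)).symm
  map₂_associator F G H := by
    ext x
    change 𝟙 (H.functor.obj (G.functor.obj (F.functor.obj x))) =
      𝟙 _ ≫ H.functor.map (𝟙 (G.functor.obj (F.functor.obj x))) ≫ 𝟙 _ ≫ 𝟙 _ ≫ 𝟙 _
    simp
  map₂_left_unitor F := by
    ext x
    change 𝟙 (F.functor.obj x) = 𝟙 (F.functor.obj x) ≫ F.functor.map (𝟙 x) ≫ 𝟙 (F.functor.obj x)
    exact ((Category.id_comp _).trans ((Category.comp_id _).trans (F.functor.map_id _))).symm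
  map₂_right_unitor F := by
    ext x
    change 𝟙 _ = 𝟙 _ ≫ 𝟙 _ ≫ 𝟙 _
    simp

/-- The nerve of `(A, E, I)`, as an object of `CAT^2`. -/
abbrev arr (X : CwA.{u}) : ArrCAT.{u} := ⟨X.E, Psh X.A, nerve X.incl⟩

theorem nerve_hom_ext (X : CwA.{u}) {D : Type (u + 1)} [LargeCategory.{u} D] (P : Psh X.A ⥤ D)
    [PreservesColimitsOfSize.{u, u} P] {e : X.E} {Z : D} (m n : P.obj ((nerve X.incl).obj e) ⟶ Z)
    (h : ∀ (a : X.A) (g : X.incl.obj a ⟶ e),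
      P.map ((X.rep a).hom) ≫ P.map ((nerve X.incl).map g) ≫ m =
        P.map ((X.rep a).hom) ≫ P.map ((nerve X.incl).map g) ≫ n) : m = n := by
  refine (isColimitOfPreserves P
    (Presheaf.isColimitTautologicalCocone ((nerve X.incl).obj e))).hom_ext (fun j => ?_)
  have hj : j.hom = (X.rep j.left).hom ≫
      (nerve X.incl).map (j.hom.app (Opposite.op j.left) (𝟙 j.left)) := by
    apply yonedaEquiv.injective
    change j.hom.app (Opposite.op j.left) (𝟙 j.left) =
      X.incl.map (𝟙 j.left) ≫ (j.hom.app (Opposite.op j.left) (𝟙 j.left))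
    exact (Category.id_comp (X := X.incl.obj j.left) _).symm.trans
      (congrArg (· ≫ _) (X.incl.map_id j.left).symm)
  have h' := h j.left (j.hom.app (Opposite.op j.left) (𝟙 j.left))
  rw [← P.map_comp_assoc, ← P.map_comp_assoc, ← hj] at h'
  exact h'

theorem hom₂_comm_of_incl (X : CwA.{u}) {Y : ArrCAT.{u}} (F G : ArrCAT.Hom X.arr Y)
    [hF : PreservesColimitsOfSize.{u, u} F.bot] (α : F.top ⟶ G.top) (β : F.bot ⟶ G.bot)
    (h : ∀ a : X.A, (F.square (X.incl.obj a)).hom ≫ Y.functor.map (α.app (X.incl.obj a)) =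
      β.app ((nerve X.incl).obj (X.incl.obj a)) ≫ (G.square (X.incl.obj a)).hom) (e : X.E) :
    (F.square e).hom ≫ Y.functor.map (α.app e) =
      β.app ((nerve X.incl).obj e) ≫ (G.square e).hom := by
  apply X.nerve_hom_ext F.bot
  intro a g
  congr 1
  have h₁ : F.bot.map ((nerve X.incl).map g) ≫ (F.square e).hom =
    (F.square (X.incl.obj a)).hom ≫ Y.functor.map (F.top.map g) := F.square_natural g
  have h₂ : G.bot.map ((nerve X.incl).map g) ≫ (G.square e).hom =
    (G.square (X.incl.obj a)).hom ≫ Y.functor.map (G.top.map g) := G.square_natural g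
  rw [reassoc_of% h₁, β.naturality_assoc, h₂, ← reassoc_of% (h a), ← Functor.map_comp,
    ← Functor.map_comp, α.naturality]

theorem hom₂_unique (X : CwA.{u}) {Y : ArrCAT.{u}} {F G : ArrCAT.Hom X.arr Y}
    [hF : PreservesColimitsOfSize.{u, u} F.bot] {β γ : F ⟶ G} (h : β.top = γ.top) : β = γ := by
  apply ArrCAT.Hom₂.ext h
  have := isLeftKanExtension_of_cocontinuous F.bot (Iso.refl (CategoryTheory.yoneda ⋙ F.bot))
  apply Functor.hom_ext_of_isLeftKanExtension F.bot (Iso.refl (CategoryTheory.yoneda ⋙ F.bot)).hom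
  ext a
  have h₁ := β.comm (X.incl.obj a)
  have h₂ := γ.comm (X.incl.obj a)
  rw [h, h₂] at h₁
  have h₃ : γ.bot.app ((nerve X.incl).obj (X.incl.obj a)) =
      β.bot.app ((nerve X.incl).obj (X.incl.obj a)) := (cancel_mono _).1 h₁
  have h₄ := β.bot.naturality ((X.rep a).hom)
  have h₅ := γ.bot.naturality ((X.rep a).hom)
  change _ ≫ β.bot.app ((nerve X.incl).obj (X.incl.obj a)) = _ at h₄
  rw [← h₃] at h₄
  have h₆ := h₄.symm.trans h₅
  have h₇ := (cancel_mono _).1 h₆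
  change 𝟙 _ ≫ β.bot.app (CategoryTheory.yoneda.obj a) =
    𝟙 _ ≫ γ.bot.app (CategoryTheory.yoneda.obj a)
  rw [h₇]

theorem exists_hom₂ (X : CwA.{u}) {Y : ArrCAT.{u}} {F G : ArrCAT.Hom X.arr Y}
    [hF : PreservesColimitsOfSize.{u, u} F.bot] (α : F.top ⟶ G.top) :
    ∃ β : F ⟶ G, β.top = α := by
  have := isLeftKanExtension_of_cocontinuous F.bot (Iso.refl (CategoryTheory.yoneda ⋙ F.bot))
  let γ : CategoryTheory.yoneda ⋙ F.bot ⟶ CategoryTheory.yoneda ⋙ G.bot :=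
    { app := fun a => F.bot.map ((X.rep a).hom) ≫ (F.square (X.incl.obj a)).hom ≫
        Y.functor.map (α.app (X.incl.obj a)) ≫ (G.square (X.incl.obj a)).inv ≫
          G.bot.map ((X.rep a).inv)
      naturality := by
        intro a a' f
        have r : CategoryTheory.yoneda.map f ≫ (X.rep a').hom =
          (X.rep a).hom ≫ (nerve X.incl).map (X.incl.map f) := X.rep_natural f
        have r' : (X.rep a).inv ≫ CategoryTheory.yoneda.map f =
            (nerve X.incl).map (X.incl.map f) ≫ (X.rep a').inv := by
          rw [Iso.inv_comp_eq, ← reassoc_of% r, Iso.hom_inv_id, Category.comp_id]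
        have h₁ : F.bot.map ((nerve X.incl).map (X.incl.map f)) ≫
            (F.square (X.incl.obj a')).hom =
          (F.square (X.incl.obj a)).hom ≫ Y.functor.map (F.top.map (X.incl.map f)) :=
          F.square_natural (X.incl.map f)
        have h₂ : G.bot.map ((nerve X.incl).map (X.incl.map f)) ≫
            (G.square (X.incl.obj a')).hom =
          (G.square (X.incl.obj a)).hom ≫ Y.functor.map (G.top.map (X.incl.map f)) :=
          G.square_natural (X.incl.map f)
        have h₃ : (G.square (X.incl.obj a)).inv ≫ G.bot.map ((nerve X.incl).map (X.incl.map f)) =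
            Y.functor.map (G.top.map (X.incl.map f)) ≫ (G.square (X.incl.obj a')).inv := by
          rw [Iso.inv_comp_eq, ← reassoc_of% h₂, Iso.hom_inv_id, Category.comp_id]
        change F.bot.map (CategoryTheory.yoneda.map f) ≫ F.bot.map (X.rep a').hom ≫ _ ≫ _ ≫ _ ≫ _ =
          (F.bot.map (X.rep a).hom ≫ (F.square (X.incl.obj a)).hom ≫
            Y.functor.map (α.app (X.incl.obj a)) ≫ (G.square (X.incl.obj a)).inv ≫
              G.bot.map (X.rep a).inv) ≫ G.bot.map (CategoryTheory.yoneda.map f)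
        simp only [Category.assoc]
        rw [← Functor.map_comp_assoc, r, ← Functor.map_comp, r', Functor.map_comp,
          Functor.map_comp, Category.assoc, reassoc_of% h₁, reassoc_of% h₃,
          ← Functor.map_comp_assoc, ← Functor.map_comp_assoc, α.naturality] }
  let β : F.bot ⟶ G.bot := F.bot.descOfIsLeftKanExtension
    (Iso.refl (CategoryTheory.yoneda ⋙ F.bot)).hom G.bot γ
  have hβ : ∀ a, β.app (CategoryTheory.yoneda.obj a) = γ.app a := fun a =>
    (Category.id_comp _).symm.trans
    (F.bot.descOfIsLeftKanExtension_fac_app (Iso.refl (CategoryTheory.yoneda ⋙ F.bot)).hom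
      G.bot γ a)
  refine ⟨⟨α, β, X.hom₂_comm_of_incl F G α β (fun a => ?_)⟩, rfl⟩
  rw [← cancel_epi (F.bot.map ((X.rep a).hom))]
  have h := β.naturality (X.rep a).hom
  rw [reassoc_of% h, hβ]
  change _ = (F.bot.map (X.rep a).hom ≫ (F.square (X.incl.obj a)).hom ≫
    Y.functor.map (α.app (X.incl.obj a)) ≫ (G.square (X.incl.obj a)).inv ≫
      G.bot.map (X.rep a).inv) ≫ _
  simp only [Category.assoc]
  rw [← Functor.map_comp_assoc G.bot (X.rep a).inv, Iso.inv_hom_id, G.bot.map_id,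
    Category.id_comp, Iso.inv_hom_id, Category.comp_id]

/-- The unique extension of a natural transformation to a 2-cell of `CAT^2`. -/
noncomputable def lift₂ (X : CwA.{u}) {Y : ArrCAT.{u}} {F G : ArrCAT.Hom X.arr Y}
    (hF : PreservesColimitsOfSize.{u, u} F.bot) (α : F.top ⟶ G.top) : F ⟶ G :=
  (X.exists_hom₂ α).choose

theorem lift₂_top (X : CwA.{u}) {Y : ArrCAT.{u}} {F G : ArrCAT.Hom X.arr Y}
    (hF : PreservesColimitsOfSize.{u, u} F.bot) (α : F.top ⟶ G.top) :
    ArrCAT.Hom₂.top (X.lift₂ hF α) = α :=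
  (X.exists_hom₂ α).choose_spec

/-- The unique extension of a natural isomorphism to an invertible 2-cell of `CAT^2`. -/
noncomputable def liftIso (X : CwA.{u}) {Y : ArrCAT.{u}} {F G : ArrCAT.Hom X.arr Y}
    (hF : PreservesColimitsOfSize.{u, u} F.bot) (hG : PreservesColimitsOfSize.{u, u} G.bot)
    (α : F.top ≅ G.top) : F ≅ G where
  hom := X.lift₂ hF α.hom
  inv := X.lift₂ hG α.inv
  hom_inv_id := by
    apply X.hom₂_unique
    change ArrCAT.Hom₂.top (X.lift₂ hF α.hom) ≫ ArrCAT.Hom₂.top (X.lift₂ hG α.inv) = 𝟙 _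
    rw [lift₂_top, lift₂_top, α.hom_inv_id]
  inv_hom_id := by
    apply X.hom₂_unique
    change ArrCAT.Hom₂.top (X.lift₂ hG α.inv) ≫ ArrCAT.Hom₂.top (X.lift₂ hF α.hom) = 𝟙 _
    rw [lift₂_top, lift₂_top, α.inv_hom_id]

/-- An arities-respecting functor as a pseudo-commuting square between nerves. -/
noncomputable def toSquare {X Y : CwA.{u}} (K : Hom X Y) : ArrCAT.Hom X.arr Y.arr where
  top := K.functor
  bot := extension K.functor
  square e := (Classical.choice K.respects).app e
  square_natural f := (Classical.choice K.respects).hom.naturality f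

theorem comp_cocontinuous {X Y Z : CwA.{u}} (K : Hom X Y) (L : Hom Y Z) :
    PreservesColimitsOfSize.{u, u} ((toSquare K).comp (toSquare L)).bot := by
  have := extension_cocontinuous K.functor
  have := extension_cocontinuous L.functor
  exact (inferInstance : PreservesColimitsOfSize.{u, u} (extension K.functor ⋙ extension L.functor))

theorem id_cocontinuous (X : CwA.{u}) :
    PreservesColimitsOfSize.{u, u} (ArrCAT.Hom.id X.arr).bot :=
  (inferInstance : PreservesColimitsOfSize.{u, u} (𝟭 (Psh X.A)))

theorem toSquare_ext {X Y : CwA.{u}} {K : Hom X Y} {G : ArrCAT.Hom X.arr Y.arr}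
    {β γ : toSquare K ⟶ G} (h : ∀ e, (ArrCAT.Hom₂.top β).app e = (ArrCAT.Hom₂.top γ).app e) :
    β = γ := by
  have := extension_cocontinuous K.functor
  exact X.hom₂_unique (F := toSquare K) (hF := this) (NatTrans.ext (funext h))

/-- `extension` is compatible with identities. -/
noncomputable def squareId (X : CwA.{u}) : toSquare (𝟙 X : X ⟶ X) ≅ ArrCAT.Hom.id X.arr :=
  X.liftIso (extension_cocontinuous _) (id_cocontinuous X) (Iso.refl (𝟭 X.E))

/-- `extension` is compatible with composition. -/
noncomputable def squareComp {X Y Z : CwA.{u}} (K : X ⟶ Y) (L : Y ⟶ Z) :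
    toSquare (K ≫ L) ≅ (toSquare K).comp (toSquare L) :=
  X.liftIso (extension_cocontinuous _) (comp_cocontinuous K L)
    (Iso.refl (Hom.functor K ⋙ Hom.functor L))

/-- The 2-cell of `CAT^2` extending a 2-cell of `CwA`; its lower component is the unique natural
transformation `extension K ⟶ extension L` compatible with `α` and the squares. -/
noncomputable def squareMap₂ {X Y : CwA.{u}} {K L : X ⟶ Y} (α : K ⟶ L) :
    toSquare K ⟶ toSquare L :=
  X.lift₂ (F := toSquare K) (G := toSquare L) (extension_cocontinuous _) (Hom₂.natTrans α)

theorem squareMap₂_top {X Y : CwA.{u}} {K L : X ⟶ Y} (α : K ⟶ L) :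
    ArrCAT.Hom₂.top (squareMap₂ α) = Hom₂.natTrans α :=
  lift₂_top X (F := toSquare K) (G := toSquare L) (extension_cocontinuous _) _

theorem squareId_hom_top (X : CwA.{u}) : ArrCAT.Hom₂.top (squareId X).hom = 𝟙 (𝟭 X.E) :=
  lift₂_top X (extension_cocontinuous _) _

theorem squareComp_hom_top {X Y Z : CwA.{u}} (K : X ⟶ Y) (L : Y ⟶ Z) :
    ArrCAT.Hom₂.top (squareComp K L).hom = 𝟙 (Hom.functor K ⋙ Hom.functor L) :=
  lift₂_top X (extension_cocontinuous _) _

theorem squareComp_inv_top {X Y Z : CwA.{u}} (K : X ⟶ Y) (L : Y ⟶ Z) :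
    ArrCAT.Hom₂.top (squareComp K L).inv = 𝟙 (Hom.functor K ⋙ Hom.functor L) :=
  lift₂_top X (comp_cocontinuous K L) _

/-- The pseudofunctor `CwA ⥤ CAT^2` sending `(A, E, I)` to its nerve. -/
noncomputable def toArr : CwA.{u} ⥤ᵖ ArrCAT.{u} where
  obj X := X.arr
  map K := toSquare K
  map₂ α := squareMap₂ α
  map₂_id K := by
    apply toSquare_ext
    intro e
    rw [squareMap₂_top]
    rfl
  map₂_comp α β := by
    apply toSquare_ext
    intro e
    change _ = (ArrCAT.Hom₂.top (squareMap₂ α)).app e ≫ (ArrCAT.Hom₂.top (squareMap₂ β)).app e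
    rw [squareMap₂_top, squareMap₂_top, squareMap₂_top]
    rfl
  mapId X := squareId X
  mapComp K L := squareComp K L
  map₂_whisker_left {X Y Z} K L L' β := by
    apply toSquare_ext
    intro e
    change _ = (ArrCAT.Hom₂.top (squareComp K L).hom).app e ≫
      (ArrCAT.Hom₂.top (squareMap₂ β)).app ((Hom.functor K).obj e) ≫
        (ArrCAT.Hom₂.top (squareComp K L').inv).app e
    rw [squareMap₂_top, squareMap₂_top, squareComp_hom_top, squareComp_inv_top]
    exact ((Category.id_comp _).trans (Category.comp_id _)).symm
  map₂_whisker_right {X Y Z} K K' α L := by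
    apply toSquare_ext
    intro e
    change _ = (ArrCAT.Hom₂.top (squareComp K L).hom).app e ≫
      (Hom.functor L).map ((ArrCAT.Hom₂.top (squareMap₂ α)).app e) ≫
        (ArrCAT.Hom₂.top (squareComp K' L).inv).app e
    rw [squareMap₂_top, squareMap₂_top, squareComp_hom_top, squareComp_inv_top]
    exact ((Category.id_comp _).trans (Category.comp_id _)).symm
  map₂_associator {X Y Z T} F G H := by
    apply toSquare_ext
    intro e
    change _ = (ArrCAT.Hom₂.top (squareComp (F ≫ G) H).hom).app e ≫
      (Hom.functor H).map ((ArrCAT.Hom₂.top (squareComp F G).hom).app e) ≫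
        𝟙 ((Hom.functor H).obj ((Hom.functor G).obj ((Hom.functor F).obj e))) ≫
          (ArrCAT.Hom₂.top (squareComp G H).inv).app ((Hom.functor F).obj e) ≫
            (ArrCAT.Hom₂.top (squareComp F (G ≫ H)).inv).app e
    rw [squareMap₂_top, squareComp_hom_top, squareComp_hom_top, squareComp_inv_top,
      squareComp_inv_top]
    change 𝟙 ((Hom.functor H).obj ((Hom.functor G).obj ((Hom.functor F).obj e))) = 𝟙 _ ≫
      (Hom.functor H).map (𝟙 ((Hom.functor G).obj ((Hom.functor F).obj e))) ≫ 𝟙 _ ≫ 𝟙 _ ≫ 𝟙 _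
    simp
  map₂_left_unitor {X Y} F := by
    apply toSquare_ext
    intro e
    change _ = (ArrCAT.Hom₂.top (squareComp (𝟙 X) F).hom).app e ≫
      (Hom.functor F).map ((ArrCAT.Hom₂.top (squareId X).hom).app e) ≫ 𝟙 ((Hom.functor F).obj e)
    rw [squareMap₂_top, squareComp_hom_top, squareId_hom_top]
    change 𝟙 ((Hom.functor F).obj e) = 𝟙 _ ≫ (Hom.functor F).map (𝟙 e) ≫ 𝟙 _
    simp
  map₂_right_unitor {X Y} F := by
    apply toSquare_ext
    intro e
    change _ = (ArrCAT.Hom₂.top (squareComp F (𝟙 Y)).hom).app e ≫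
      (ArrCAT.Hom₂.top (squareId Y).hom).app ((Hom.functor F).obj e) ≫ 𝟙 ((Hom.functor F).obj e)
    rw [squareMap₂_top, squareComp_hom_top, squareId_hom_top]
    change 𝟙 ((Hom.functor F).obj e) = 𝟙 _ ≫ 𝟙 _ ≫ 𝟙 _
    simp

/-- The pseudofunctor `CwA ⥤ Prof` sending `(A, E, I)` to `A` and `K` to `extension K`. -/
noncomputable def toProf : CwA.{u} ⥤ᵖ Prof.{u} where
  obj X := ⟨X.A⟩
  map K := ⟨extension (Hom.functor K), extension_cocontinuous _⟩
  map₂ α := ⟨ArrCAT.Hom₂.bot (squareMap₂ α)⟩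
  map₂_id K := Prof.Hom₂.ext (congrArg ArrCAT.Hom₂.bot (toArr.map₂_id K))
  map₂_comp α β := Prof.Hom₂.ext (congrArg ArrCAT.Hom₂.bot (toArr.map₂_comp α β))
  mapId X :=
    { hom := ⟨ArrCAT.Hom₂.bot (squareId X).hom⟩
      inv := ⟨ArrCAT.Hom₂.bot (squareId X).inv⟩
      hom_inv_id := Prof.Hom₂.ext (congrArg ArrCAT.Hom₂.bot (squareId X).hom_inv_id)
      inv_hom_id := Prof.Hom₂.ext (congrArg ArrCAT.Hom₂.bot (squareId X).inv_hom_id) }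
  mapComp K L :=
    { hom := ⟨ArrCAT.Hom₂.bot (squareComp K L).hom⟩
      inv := ⟨ArrCAT.Hom₂.bot (squareComp K L).inv⟩
      hom_inv_id := Prof.Hom₂.ext (congrArg ArrCAT.Hom₂.bot (squareComp K L).hom_inv_id)
      inv_hom_id := Prof.Hom₂.ext (congrArg ArrCAT.Hom₂.bot (squareComp K L).inv_hom_id) }
  map₂_whisker_left K _ _ β :=
    Prof.Hom₂.ext (congrArg ArrCAT.Hom₂.bot (toArr.map₂_whisker_left K β))
  map₂_whisker_right α L :=
    Prof.Hom₂.ext (congrArg ArrCAT.Hom₂.bot (toArr.map₂_whisker_right α L))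
  map₂_associator F G H :=
    Prof.Hom₂.ext (congrArg ArrCAT.Hom₂.bot (toArr.map₂_associator F G H))
  map₂_left_unitor F := Prof.Hom₂.ext (congrArg ArrCAT.Hom₂.bot (toArr.map₂_left_unitor F))
  map₂_right_unitor F := Prof.Hom₂.ext (congrArg ArrCAT.Hom₂.bot (toArr.map₂_right_unitor F))

end CwA

end Arities

/-!
The functor `nerve I : E ⥤ Psh A` is a limit in `CAT^2` of the nerves `N_j` of the categories with
arities `D j`. The proof tests this limit against three kinds of arrows `X` of `CAT`.

* *Density.* A functor `N` is fully faithful exactly if restriction of 2-cells along the inclusion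
  of `∅ ⟶ 1` into `1 ⟶ 1` is bijective (`ArrCAT.full_faithful_of_precomp`). This lifting property
  passes from the `N_j` to their limit (`WeightedCone.IsLimit.precomp_full_faithful`), so `nerve I`
  is fully faithful. For `I` full this says that `I` is dense.

* *Cocontinuity.* 1-cells out of `∅ ⟶ C` are functors into the codomain, so the lower components
  `H : Psh A ⥤ Psh A_j` of the legs of `nu` form a limit of categories. They are jointly
  conservative, and a limit of cocomplete categories along cocontinuous functors has cocontinuous
  projections: the colimits of the images of a diagram `d` in `Psh A` under the `H` form a cone of
  points (`ArrCAT.colimitCone`), hence come from an object of `Psh A`, which is shown to be the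
  colimit of `d` (`ArrCAT.preservesColimitsOfShape_legBot`). Consequently a functor into `Psh A` is
  cocontinuous as soon as its composites with the `H` are.

* *The cone.* A square of nerves with cocontinuous lower functor is the same thing as an
  arities-respecting functor, and 2-cells out of it are determined by their upper component. So `nu`
  lifts to a cone over `D` (`CwA.liftCone`, `CwA.mapLiftCone`).

* *The limits.* Each of the three universal properties follows from that of `nu` by one comparison
  principle (`HomTransform.isEquivalence_restriction`): cones in `CwA`, `Prof` and `CAT` embed fully
  faithfully into cones in `CAT^2`, with vertices respectively a nerve, `∅ ⟶ Psh B`, and the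
  identity of `C`, and the 1-cells that induce a cone in the image are those in the image. In
  the first two cases the image consists of the 1-cells with cocontinuous lower functor; in the last
  it is everything.
-/

/-! ### Weighted cones and transformations of representables -/

namespace WeightedLimits

section Transform

universe w v w₁ v₁ u₁ w₂ v₂ u₂ w₃ v₃ u₃

variable {J : Type u₁} [Bicategory.{w₁, v₁} J] {B : Type u₂} [Bicategory.{w₂, v₂} B]
  {C : Type u₃} [Bicategory.{w₃, v₃} C] {W : J ⥤ᵖ Cat.{w, v}}

namespace WeightedCone

@[ext]
theorem hom_ext {D : J ⥤ᵖ B} {x : B} {κ κ' : WeightedCone W D x} {m n : κ ⟶ κ'}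
    (h : ∀ j a, (Hom.app m j).app a = (Hom.app n j).app a) : m = n :=
  Hom.ext (funext fun j => NatTrans.ext (funext fun a => h j a))

/-- A modification with invertible components is invertible. -/
def isoMk {D : J ⥤ᵖ B} {x : B} {κ κ' : WeightedCone W D x}
    (φ : ∀ (j : J) (a : W.obj j), (κ.leg j).obj a ≅ (κ'.leg j).obj a)
    (natural : ∀ (j : J) {a b : W.obj j} (t : a ⟶ b),
      (κ.leg j).map t ≫ (φ j b).hom = (φ j a).hom ≫ (κ'.leg j).map t)
    (comm : ∀ {i j : J} (f : i ⟶ j) (a : W.obj i),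
      (κ.square f a).hom ≫ (φ j ((W.map f).toFunctor.obj a)).hom =
        (φ i a).hom ▷ D.map f ≫ (κ'.square f a).hom) : κ ≅ κ' where
  hom :=
    { app := fun j => { app := fun a => (φ j a).hom, naturality := fun _ _ t => natural j t }
      comm := comm }
  inv :=
    { app := fun j =>
        { app := fun a => (φ j a).inv
          naturality := fun a b t => by rw [Iso.comp_inv_eq, Category.assoc, natural,
            Iso.inv_hom_id_assoc] }
      comm := fun {i j} f a => by
        change _ ≫ (φ j _).inv = (φ i a).inv ▷ D.map f ≫ _
        rw [Iso.comp_inv_eq, Category.assoc, comm, inv_hom_whiskerRight_assoc] }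
  hom_inv_id := hom_ext fun j a => (φ j a).hom_inv_id
  inv_hom_id := hom_ext fun j a => (φ j a).inv_hom_id

/-- The components of an isomorphism of weighted cones. -/
def isoApp {D : J ⥤ᵖ B} {x : B} {κ κ' : WeightedCone W D x} (e : κ ≅ κ') (j : J) (a : W.obj j) :
    (κ.leg j).obj a ≅ (κ'.leg j).obj a where
  hom := (Hom.app e.hom j).app a
  inv := (Hom.app e.inv j).app a
  hom_inv_id := congrArg (fun m : κ ⟶ κ => (Hom.app m j).app a) e.hom_inv_id
  inv_hom_id := congrArg (fun m : κ' ⟶ κ' => (Hom.app m j).app a) e.inv_hom_id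

/-- A morphism of weighted cones is invertible if its components are. -/
theorem isIso_of_components {D : J ⥤ᵖ B} {x : B} {κ κ' : WeightedCone W D x} (m : κ ⟶ κ')
    (h : ∀ j a, IsIso ((Hom.app m j).app a)) : IsIso m := by
  have e : m = (isoMk (fun j a => asIso ((Hom.app m j).app a))
    (fun j _ _ t => (Hom.app m j).naturality t) (fun f a => Hom.comm m f a)).hom := rfl
  rw [e]
  infer_instance

end WeightedCone

/-- A pseudonatural transformation `B(x, D₁ -) ⇒ C(y, D₂ -)` between representables restricted
along two diagrams of the same shape, written out in components. -/
structure HomTransform (D₁ : J ⥤ᵖ B) (x : B) (D₂ : J ⥤ᵖ C) (y : C) where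
  functor (j : J) : (x ⟶ D₁.obj j) ⥤ (y ⟶ D₂.obj j)
  square {i j : J} (f : i ⟶ j) (h : x ⟶ D₁.obj i) :
    (functor i).obj h ≫ D₂.map f ≅ (functor j).obj (h ≫ D₁.map f)
  square_natural {i j : J} (f : i ⟶ j) {h h' : x ⟶ D₁.obj i} (β : h ⟶ h') :
    (functor i).map β ▷ D₂.map f ≫ (square f h').hom =
      (square f h).hom ≫ (functor j).map (β ▷ D₁.map f)
  square_map₂ {i j : J} {f g : i ⟶ j} (θ : f ⟶ g) (h : x ⟶ D₁.obj i) :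
    (functor i).obj h ◁ D₂.map₂ θ ≫ (square g h).hom =
      (square f h).hom ≫ (functor j).map (h ◁ D₁.map₂ θ)
  square_id (i : J) (h : x ⟶ D₁.obj i) :
    (square (𝟙 i) h).hom ≫ (functor i).map (h ◁ (D₁.mapId i).hom ≫ (ρ_ h).hom) =
      (functor i).obj h ◁ (D₂.mapId i).hom ≫ (ρ_ ((functor i).obj h)).hom
  square_comp {i j k : J} (f : i ⟶ j) (g : j ⟶ k) (h : x ⟶ D₁.obj i) :
    (square (f ≫ g) h).hom ≫ (functor k).map
        (h ◁ (D₁.mapComp f g).hom ≫ (α_ h (D₁.map f) (D₁.map g)).inv) =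
      (functor i).obj h ◁ (D₂.mapComp f g).hom ≫
        (α_ ((functor i).obj h) (D₂.map f) (D₂.map g)).inv ≫
          (square f h).hom ▷ D₂.map g ≫ (square g (h ≫ D₁.map f)).hom

namespace HomTransform

variable {D₁ : J ⥤ᵖ B} {x : B} {D₂ : J ⥤ᵖ C} {y : C}

/-- Postcomposition of a weighted cone, seen as a pseudonatural transformation out of the weight,
with a transformation of representables. -/
def mapConeObj (T : HomTransform D₁ x D₂ y) (κ : WeightedCone W D₁ x) : WeightedCone W D₂ y where
  leg j := κ.leg j ⋙ T.functor j
  square {i j} f a := T.square f ((κ.leg i).obj a) ≪≫ (T.functor j).mapIso (κ.square f a)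
  square_natural {i j} f a b t := by
    change (T.functor i).map _ ▷ _ ≫ (T.square f _).hom ≫ (T.functor j).map _ =
      ((T.square f _).hom ≫ (T.functor j).map _) ≫ (T.functor j).map _
    rw [reassoc_of% (T.square_natural f ((κ.leg i).map t)), Category.assoc, ← Functor.map_comp,
      ← Functor.map_comp, κ.square_natural]
  square_map₂ {i j f g} θ a := by
    change (T.functor i).obj _ ◁ _ ≫ (T.square g _).hom ≫ (T.functor j).map _ =
      ((T.square f _).hom ≫ (T.functor j).map _) ≫ (T.functor j).map _
    rw [reassoc_of% (T.square_map₂ θ ((κ.leg i).obj a)), Category.assoc, ← Functor.map_comp,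
      ← Functor.map_comp, κ.square_map₂]
  square_id i a := by
    change ((T.square (𝟙 i) _).hom ≫ (T.functor i).map _) ≫ (T.functor i).map _ = _
    rw [Category.assoc, ← Functor.map_comp, κ.square_id]
    exact T.square_id i _
  square_comp {i j k} f g a := by
    change ((T.square (f ≫ g) _).hom ≫ (T.functor k).map _) ≫ (T.functor k).map _ =
      (T.functor i).obj _ ◁ _ ≫ (α_ _ _ _).inv ≫
        ((T.square f _).hom ≫ (T.functor j).map _) ▷ _ ≫ (T.square g _).hom ≫ (T.functor k).map _
    have h := T.square_comp f g ((κ.leg i).obj a)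
    rw [Functor.map_comp] at h
    rw [Category.assoc, ← Functor.map_comp, κ.square_comp, comp_whiskerRight, Category.assoc,
      reassoc_of% (T.square_natural g (κ.square f a).hom), Functor.map_comp, Functor.map_comp,
      Functor.map_comp, reassoc_of% h]

/-- The functor on categories of weighted cones induced by a transformation of representables. -/
def mapCone (T : HomTransform D₁ x D₂ y) : WeightedCone W D₁ x ⥤ WeightedCone W D₂ y where
  obj κ := T.mapConeObj κ
  map {κ κ'} m :=
    { app := fun j => Functor.whiskerRight (WeightedCone.Hom.app m j) (T.functor j)
      comm := fun {i j} f a => by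
        change ((T.square f _).hom ≫ (T.functor j).map _) ≫ (T.functor j).map _ =
          (T.functor i).map _ ▷ _ ≫ (T.square f _).hom ≫ (T.functor j).map _
        rw [reassoc_of% (T.square_natural f ((WeightedCone.Hom.app m i).app a)), Category.assoc,
          ← Functor.map_comp, ← Functor.map_comp, WeightedCone.Hom.comm] }
  map_id κ := WeightedCone.hom_ext fun j a => (T.functor j).map_id _
  map_comp _ _ := WeightedCone.hom_ext fun j a => (T.functor j).map_comp _ _

variable (T : HomTransform D₁ x D₂ y)

instance mapCone_faithful [∀ j, (T.functor j).Faithful] :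
    (T.mapCone (W := W)).Faithful where
  map_injective {κ κ' _ _} h := WeightedCone.hom_ext fun j a => (T.functor j).map_injective
    (congrArg (fun p : T.mapConeObj κ ⟶ T.mapConeObj κ' => (WeightedCone.Hom.app p j).app a) h)

instance mapCone_full [∀ j, (T.functor j).Full] [∀ j, (T.functor j).Faithful] :
    (T.mapCone (W := W)).Full where
  map_surjective {κ κ'} m := by
    have hm : ∀ j a, ∃ n : (κ.leg j).obj a ⟶ (κ'.leg j).obj a,
        (T.functor j).map n = (WeightedCone.Hom.app m j).app a :=
      fun j a => (T.functor j).map_surjective _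
    choose n hn using hm
    refine ⟨{ app := fun j =>
                { app := n j, naturality := fun a b t => (T.functor j).map_injective ?_ }
              comm := fun {i j} f a => (T.functor j).map_injective ?_ },
      WeightedCone.hom_ext fun j a => hn j a⟩
    · rw [Functor.map_comp, Functor.map_comp, hn, hn]
      exact (WeightedCone.Hom.app m j).naturality t
    · have h : ((T.square f ((κ.leg i).obj a)).hom ≫ (T.functor j).map (κ.square f a).hom) ≫
          (T.functor j).map (n j _) = (T.functor i).map (n i a) ▷ D₂.map f ≫
            (T.square f ((κ'.leg i).obj a)).hom ≫ (T.functor j).map (κ'.square f a).hom := by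
        rw [hn, hn]
        exact WeightedCone.Hom.comm m f a
      rw [Category.assoc, reassoc_of% (T.square_natural f (n i a)), cancel_epi,
        ← Functor.map_comp, ← Functor.map_comp] at h
      exact h

/-- Restriction along 1-cells into the vertex of `κ₁` is an equivalence if the comparison of cones
with the limit cone `κ₂` is fully faithful, and 1-cells into the vertex of `κ₂` that induce
a cone in its image lie in the image of the comparison of 1-cells. -/
theorem isEquivalence_restriction {v₁ : B} {v₂ : C} [∀ j, (T.functor j).Full]
    [∀ j, (T.functor j).Faithful] {κ₁ : WeightedCone W D₁ v₁} {κ₂ : WeightedCone W D₂ v₂}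
    (h₂ : κ₂.IsLimit) (S : (x ⟶ v₁) ⥤ (y ⟶ v₂)) [S.Full] [S.Faithful]
    (e : κ₁.restriction x ⋙ T.mapCone ≅ S ⋙ κ₂.restriction y)
    (hS : ∀ (μ : WeightedCone W D₁ x) (g : y ⟶ v₂), (κ₂.restrict g ≅ T.mapConeObj μ) →
      S.essImage g) :
    (κ₁.restriction x).IsEquivalence := by
  have := h₂ y
  have hf : (κ₁.restriction x ⋙ T.mapCone).Faithful := Functor.Faithful.of_iso e.symm
  have hF : (κ₁.restriction x ⋙ T.mapCone).Full := Functor.Full.of_iso e.symm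
  have : (κ₁.restriction x).Faithful := Functor.Faithful.of_comp _ T.mapCone
  have : (κ₁.restriction x).Full := Functor.Full.of_comp_faithful _ T.mapCone
  have : (κ₁.restriction x).EssSurj := ⟨fun μ => by
    obtain ⟨g', ⟨i⟩⟩ := hS μ _ ((κ₂.restriction y).objObjPreimageIso (T.mapConeObj μ))
    exact ⟨g', ⟨T.mapCone.preimageIso (e.app g' ≪≫ (κ₂.restriction y).mapIso i ≪≫
      (κ₂.restriction y).objObjPreimageIso (T.mapConeObj μ))⟩⟩⟩
  exact { }

/-- A pseudofunctor acts on the 1-cells and 2-cells into a diagram. -/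
def ofPseudofunctor (F : B ⥤ᵖ C) (D : J ⥤ᵖ B) (x : B) :
    HomTransform D x (D.comp F) (F.obj x) where
  functor j := F.mapFunctor x (D.obj j)
  square f h := (F.mapComp h (D.map f)).symm
  square_natural f h h' β := by
    change F.map₂ _ ▷ F.map _ ≫ _ = _ ≫ F.map₂ _
    simp
  square_map₂ θ h := by
    change F.map _ ◁ F.map₂ _ ≫ _ = _ ≫ F.map₂ _
    simp
  square_id i h := by
    change _ ≫ F.map₂ _ = F.map _ ◁ (F.map₂ _ ≫ (F.mapId _).hom) ≫ (ρ_ (F.map _)).hom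
    simp
  square_comp f g h := by
    change _ ≫ F.map₂ _ = F.map _ ◁ (F.map₂ _ ≫ (F.mapComp _ _).hom) ≫
      (α_ (F.map _) (F.map _) (F.map _)).inv ≫ _ ▷ F.map _ ≫ _
    have h' : F.map₂ (α_ h (D.map f) (D.map g)).inv =
        (F.mapComp h (D.map f ≫ D.map g)).hom ≫
          F.map h ◁ (F.mapComp (D.map f) (D.map g)).hom ≫
            (α_ _ _ _).inv ≫ (F.mapComp h (D.map f)).inv ▷ F.map (D.map g) ≫
              (F.mapComp (h ≫ D.map f) (D.map g)).inv := by
      rw [← cancel_mono (F.mapComp (h ≫ D.map f) (D.map g)).hom,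
        F.mapComp_assoc_right_hom_assoc]
      simp
    simp [h']
    rfl

/-- Precomposition with a 1-cell. -/
def ofPrecomp (D : J ⥤ᵖ B) {x y : B} (p : y ⟶ x) : HomTransform D x D y where
  functor j := precomp (D.obj j) p
  square f h := α_ p h (D.map f)
  square_natural f h h' β := by
    change (p ◁ β) ▷ _ ≫ (α_ _ _ _).hom = (α_ _ _ _).hom ≫ p ◁ _
    simp
  square_map₂ θ h := by
    change (p ≫ h) ◁ _ ≫ (α_ _ _ _).hom = (α_ _ _ _).hom ≫ p ◁ _
    simp
  square_id i h := by
    change (α_ _ _ _).hom ≫ p ◁ _ = (p ≫ h) ◁ _ ≫ (ρ_ (p ≫ h)).hom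
    simp
  square_comp f g h := by
    change (α_ _ _ _).hom ≫ p ◁ _ = (p ≫ h) ◁ _ ≫ (α_ (p ≫ h) _ _).inv ≫
      (α_ _ _ _).hom ▷ _ ≫ (α_ _ _ _).hom
    simp

end HomTransform

/-- Isomorphic weighted cones have isomorphic restriction functors. -/
def WeightedCone.restrictionIsoOfIso {D : J ⥤ᵖ B} {x : B} {κ κ' : WeightedCone W D x}
    (e : κ ≅ κ') (y : B) : κ.restriction y ≅ κ'.restriction y :=
  NatIso.ofComponents
    (fun g => isoMk (fun j a => whiskerLeftIso g (isoApp e j a))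
      (fun j a b t => by
        have h : (κ.leg j).map t ≫ (isoApp e j b).hom = (isoApp e j a).hom ≫ (κ'.leg j).map t :=
          (Hom.app e.hom j).naturality t
        change g ◁ _ ≫ g ◁ (isoApp e j b).hom = g ◁ (isoApp e j a).hom ≫ g ◁ _
        rw [← Bicategory.whiskerLeft_comp, h, Bicategory.whiskerLeft_comp])
      (fun {i j} f a => by
        have h : (κ.square f a).hom ≫ (isoApp e j ((W.map f).toFunctor.obj a)).hom =
          (isoApp e i a).hom ▷ D.map f ≫ (κ'.square f a).hom := Hom.comm e.hom f a
        change ((α_ _ _ _).hom ≫ g ◁ _) ≫ g ◁ (isoApp e j _).hom =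
          (g ◁ (isoApp e i a).hom) ▷ _ ≫ (α_ _ _ _).hom ≫ g ◁ _
        rw [Category.assoc, ← Bicategory.whiskerLeft_comp, h]
        simp))
    (fun {g g'} β => hom_ext fun j a => whisker_exchange β (isoApp e j a).hom |>.symm)

/-- Mapping the restrictions of a weighted cone along a pseudofunctor amounts to restricting the
mapped cone. -/
def HomTransform.restrictionMapIso {D : J ⥤ᵖ B} {x : B} (κ : WeightedCone W D x) (F : B ⥤ᵖ C)
    (y : B) : κ.restriction y ⋙ (HomTransform.ofPseudofunctor F D y).mapCone ≅
      F.mapFunctor y x ⋙ (κ.map F).restriction (F.obj y) :=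
  NatIso.ofComponents
    (fun g => WeightedCone.isoMk (fun j a => F.mapComp g ((κ.leg j).obj a))
      (fun j a b t => by
        change F.map₂ (g ◁ _) ≫ (F.mapComp _ _).hom = (F.mapComp _ _).hom ≫ F.map g ◁ F.map₂ _
        simp)
      (fun {i j} f a => by
        change ((F.mapComp (g ≫ _) _).inv ≫ F.map₂ ((α_ _ _ _).hom ≫ g ◁ _)) ≫
            (F.mapComp g _).hom =
          (F.mapComp g _).hom ▷ F.map _ ≫ (α_ (F.map g) (F.map _) (F.map _)).hom ≫
            F.map g ◁ ((F.mapComp _ _).inv ≫ F.map₂ _)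
        simp))
    (fun {g g'} β => WeightedCone.hom_ext fun j a => by
      change F.map₂ (β ▷ _) ≫ (F.mapComp _ _).hom = (F.mapComp _ _).hom ≫ F.map₂ β ▷ F.map _
      simp)

/-- Local full faithfulness of precomposition passes from the objects of a diagram to its
limit. -/
theorem WeightedCone.IsLimit.precomp_full_faithful {D : J ⥤ᵖ B} {v x y : B}
    {κ : WeightedCone W D v} (hκ : κ.IsLimit) (p : y ⟶ x)
    [∀ j, (precomp (D.obj j) p).Full] [∀ j, (precomp (D.obj j) p).Faithful] :
    (precomp v p).Full ∧ (precomp v p).Faithful := by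
  have := hκ x
  have := hκ y
  have : ∀ j, ((HomTransform.ofPrecomp D p).functor j).Full := fun j =>
    inferInstanceAs (precomp (D.obj j) p).Full
  have : ∀ j, ((HomTransform.ofPrecomp D p).functor j).Faithful := fun j =>
    inferInstanceAs (precomp (D.obj j) p).Faithful
  let e : precomp v p ⋙ κ.restriction y ≅
      κ.restriction x ⋙ (HomTransform.ofPrecomp D p).mapCone :=
    NatIso.ofComponents (fun g => WeightedCone.isoMk (fun j a => α_ p g ((κ.leg j).obj a))
        (fun j a b t => by
          change (p ≫ g) ◁ _ ≫ (α_ _ _ _).hom = (α_ _ _ _).hom ≫ p ◁ g ◁ _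
          simp)
        (fun {i j} f a => by
          change ((α_ _ _ _).hom ≫ (p ≫ g) ◁ _) ≫ (α_ _ _ _).hom = (α_ _ _ _).hom ▷ _ ≫
            (α_ _ _ _).hom ≫ p ◁ ((α_ _ _ _).hom ≫ g ◁ _)
          simp))
      (fun {g g'} β => WeightedCone.hom_ext fun j a => by
        change (p ◁ β) ▷ _ ≫ (α_ _ _ _).hom = (α_ _ _ _).hom ≫ p ◁ (β ▷ _)
        simp)
  have : (precomp v p ⋙ κ.restriction y).Full := Functor.Full.of_iso e.symm
  have : (precomp v p ⋙ κ.restriction y).Faithful := Functor.Faithful.of_iso e.symm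
  exact ⟨Functor.Full.of_comp_faithful _ (κ.restriction y),
    Functor.Faithful.of_comp _ (κ.restriction y)⟩

end Transform

end WeightedLimits

namespace Arities

open Limits WeightedLimits

/-! ### Arrows of `CAT` that represent domains and codomains, and density -/

namespace ArrCAT

/-- The empty category, as a locally small category. -/
abbrev EmptyCat : Type (u + 1) := ULift.{u + 1} (Discrete PEmpty.{u + 1})

instance : LargeCategory.{u} EmptyCat.{u} := uliftCategory _

/-- The terminal category, as a locally small category. -/
abbrev PointCat : Type (u + 1) := ULift.{u + 1} (Discrete PUnit.{u + 1})

instance : LargeCategory.{u} PointCat.{u} := uliftCategory _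

/-- The object of the terminal category. -/
abbrev point : PointCat.{u} := ⟨⟨PUnit.unit⟩⟩

/-- The functor out of the empty category. -/
def fromEmpty (C : Type (u + 1)) [LargeCategory.{u} C] : EmptyCat.{u} ⥤ C where
  obj e := e.down.as.elim
  map {e} := e.down.as.elim
  map_id e := e.down.as.elim
  map_comp {e} := e.down.as.elim

/-- The arrow `∅ ⟶ C` of `CAT`. It represents the functors from `C` to the codomain of an arrow. -/
abbrev emptyTo (C : Type (u + 1)) [LargeCategory.{u} C] : ArrCAT.{u} :=
  ⟨EmptyCat, C, fromEmpty C⟩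

/-- The identity arrow of `C`. It represents, up to equivalence, the functors from `C` to the
domain of an arrow. -/
abbrev idArr (C : Type (u + 1)) [LargeCategory.{u} C] : ArrCAT.{u} := ⟨C, C, 𝟭 C⟩

variable {C : Type (u + 1)} [LargeCategory.{u} C] {Y : ArrCAT.{u}}

/-- The 1-cell `(∅ ⟶ C) ⟶ Y` given by a functor to the codomain of `Y`. -/
def ofBot (F : C ⥤ Y.cod) : emptyTo C ⟶ Y where
  top := fromEmpty _
  bot := F
  square e := e.down.as.elim
  square_natural {e} := e.down.as.elim

/-- A 2-cell between 1-cells `(∅ ⟶ C) ⟶ Y` is a natural transformation of lower components. -/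
def ofBot₂ {F G : emptyTo C ⟶ Y} (β : Hom.bot F ⟶ Hom.bot G) : F ⟶ G where
  top :=
    { app := fun e => e.down.as.elim
      naturality := fun e => e.down.as.elim }
  bot := β
  comm e := e.down.as.elim

theorem emptyTo_hom_ext {F G : emptyTo C ⟶ Y} {β γ : F ⟶ G}
    (h : ∀ c : C, (Hom₂.bot β).app c = (Hom₂.bot γ).app c) : β = γ :=
  Hom₂.ext (NatTrans.ext (funext fun e => e.down.as.elim)) (NatTrans.ext (funext h))

/-- The square of a 1-cell out of an identity arrow. -/
def idSquare (F : idArr C ⟶ Y) (c : C) :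
    (Hom.bot F).obj c ≅ Y.functor.obj ((Hom.top F).obj c) := Hom.square F c

theorem idSquare_natural (F : idArr C ⟶ Y) {c c' : C} (f : c ⟶ c') :
    (Hom.bot F).map f ≫ (idSquare F c').hom =
      (idSquare F c).hom ≫ Y.functor.map ((Hom.top F).map f) := Hom.square_natural F f

theorem idSquare_inv_natural (F : idArr C ⟶ Y) {c c' : C} (f : c ⟶ c') :
    (idSquare F c).inv ≫ (Hom.bot F).map f =
      Y.functor.map ((Hom.top F).map f) ≫ (idSquare F c').inv := by
  rw [Iso.inv_comp_eq, ← reassoc_of% (idSquare_natural F f), Iso.hom_inv_id, Category.comp_id]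

theorem idSquare_comm {F G : idArr C ⟶ Y} (β : F ⟶ G) (c : C) :
    (idSquare F c).hom ≫ Y.functor.map ((Hom₂.top β).app c) =
      (Hom₂.bot β).app c ≫ (idSquare G c).hom := Hom₂.comm β c

/-- A 2-cell between 1-cells out of an identity arrow from its upper component. -/
def ofTop₂ {F G : idArr C ⟶ Y} (α : Hom.top F ⟶ Hom.top G) : F ⟶ G where
  top := α
  bot :=
    { app := fun (c : C) => (idSquare F c).hom ≫ Y.functor.map (α.app c) ≫ (idSquare G c).inv
      naturality := fun (c c' : C) f => by
        rw [reassoc_of% (idSquare_natural F f), Category.assoc, Category.assoc,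
          idSquare_inv_natural, ← Functor.map_comp_assoc, ← Functor.map_comp_assoc,
          α.naturality] }
  comm (c : C) := by
    change (idSquare F c).hom ≫ _ = ((idSquare F c).hom ≫ Y.functor.map (α.app c) ≫
      (idSquare G c).inv) ≫ (idSquare G c).hom
    simp

/-- The upper component of a 2-cell out of an identity arrow determines the lower one, since the
squares of 1-cells are invertible. -/
theorem idArr_hom_ext {F G : idArr C ⟶ Y} {β γ : F ⟶ G}
    (h : ∀ c : C, (Hom₂.top β).app c = (Hom₂.top γ).app c) : β = γ := by
  refine Hom₂.ext (NatTrans.ext (funext h)) (NatTrans.ext (funext fun c => ?_))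
  have h₁ := idSquare_comm β c
  rw [h c, idSquare_comm γ c] at h₁
  exact ((cancel_mono _).1 h₁).symm

/-- The inclusion of `∅ ⟶ C` into the identity arrow of `C`. -/
def emptyToIdArr (C : Type (u + 1)) [LargeCategory.{u} C] : emptyTo C ⟶ idArr C :=
  ofBot (Y := idArr C) (𝟭 C)

instance precomp_emptyToIdArr_faithful [Y.functor.Faithful] :
    (precomp Y (emptyToIdArr C)).Faithful where
  map_injective {F G β γ} h := by
    have hb : ∀ c : C, (Hom₂.bot β).app c = (Hom₂.bot γ).app c := fun c =>
      congrArg (fun ξ : emptyToIdArr C ≫ F ⟶ emptyToIdArr C ≫ G => (Hom₂.bot ξ).app c) h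
    refine idArr_hom_ext fun c => Y.functor.map_injective ?_
    have h₁ := idSquare_comm β c
    rw [hb c, ← idSquare_comm γ c] at h₁
    exact (cancel_epi _).1 h₁

/-- For `Y.functor` fully faithful, the upper component of a 2-cell into `Y` can be reconstructed
from the lower one. -/
instance precomp_emptyToIdArr_full [Y.functor.Full] [Y.functor.Faithful] :
    (precomp Y (emptyToIdArr C)).Full where
  map_surjective {F G} ξ := by
    let b : Hom.bot F ⟶ Hom.bot G :=
      { app := fun c => (Hom₂.bot ξ).app c, naturality := fun _ _ f => (Hom₂.bot ξ).naturality f }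
    have hn : ∀ c : C, ∃ n : (Hom.top F).obj c ⟶ (Hom.top G).obj c, Y.functor.map n =
        (idSquare F c).inv ≫ b.app c ≫ (idSquare G c).hom :=
      fun c => Y.functor.map_surjective _
    choose n hn using hn
    refine ⟨ofTop₂ { app := n, naturality := fun (c c' : C) f => Y.functor.map_injective ?_ },
      emptyTo_hom_ext fun c => ?_⟩
    · rw [Functor.map_comp, Functor.map_comp, hn, hn, ← reassoc_of% (idSquare_inv_natural F f),
        b.naturality_assoc, idSquare_natural, Category.assoc, Category.assoc]
    · change (idSquare F c).hom ≫ Y.functor.map (n c) ≫ (idSquare G c).inv = b.app c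
      rw [hn]
      simp

/-- The 1-cell from the identity arrow of the point given by an object of the domain. -/
def constId (e : Y.dom) : idArr PointCat.{u} ⟶ Y where
  top := (Functor.const _).obj e
  bot := (Functor.const _).obj (Y.functor.obj e)
  square _ := Iso.refl _
  square_natural _ := by
    change 𝟙 _ ≫ 𝟙 _ = 𝟙 _ ≫ Y.functor.map (𝟙 e)
    simp

/-- Fully faithful functors are characterized, as objects of `CAT^2`, by a lifting property for
2-cells against the inclusion of `∅ ⟶ 1` into `1 ⟶ 1`. -/
theorem full_faithful_of_precomp [(precomp Y (emptyToIdArr PointCat.{u})).Full]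
    [(precomp Y (emptyToIdArr PointCat.{u})).Faithful] : Y.functor.Full ∧ Y.functor.Faithful := by
  refine ⟨⟨fun {e e'} φ => ?_⟩, ⟨fun {e e' f f'} h => ?_⟩⟩
  · obtain ⟨β, hβ⟩ := (precomp Y (emptyToIdArr PointCat.{u})).map_surjective
      (X := constId e) (Y := constId e')
      (ofBot₂ (F := emptyToIdArr PointCat.{u} ≫ constId e)
        (G := emptyToIdArr PointCat.{u} ≫ constId e') ((Functor.const PointCat.{u}).map φ))
    have h₁ : (Hom₂.bot β).app point = φ := congrArg
      (fun ξ : emptyToIdArr PointCat.{u} ≫ constId e ⟶ emptyToIdArr PointCat.{u} ≫ constId e' =>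
        (Hom₂.bot ξ).app point) hβ
    have h₂ : 𝟙 _ ≫ Y.functor.map ((Hom₂.top β).app point) = (Hom₂.bot β).app point ≫ 𝟙 _ :=
      Hom₂.comm β point
    rw [Category.id_comp, Category.comp_id] at h₂
    exact ⟨_, h₂.trans h₁⟩
  · have h' := (precomp Y (emptyToIdArr PointCat.{u})).map_injective
      (X := constId e) (Y := constId e')
      (a₁ := ofTop₂ ((Functor.const PointCat.{u}).map f))
      (a₂ := ofTop₂ ((Functor.const PointCat.{u}).map f')) (emptyTo_hom_ext fun c => by
        change 𝟙 _ ≫ Y.functor.map f ≫ 𝟙 _ = 𝟙 _ ≫ Y.functor.map f' ≫ 𝟙 _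
        rw [h])
    exact congrArg (fun β : constId e ⟶ constId e' => (Hom₂.top β).app point) h'

end ArrCAT

section Dense

variable {A : Type u} [SmallCategory A] {E : Type (u + 1)} [LargeCategory.{u} E] (I : A ⥤ E)

/-- The two conventions for the nerve of a functor agree. -/
def nerveIso : Presheaf.restrictedULiftYoneda.{u} I ≅ nerve I :=
  Functor.isoWhiskerRight uliftYonedaIsoYoneda.{u} _

theorem nerve_full [I.IsDense] : (nerve I).Full := Functor.Full.of_iso (nerveIso I)

theorem nerve_faithful [I.IsDense] : (nerve I).Faithful := Functor.Faithful.of_iso (nerveIso I)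

theorem isDense_of_nerve [I.Full] [(nerve I).Full] [(nerve I).Faithful] : I.IsDense := by
  have := Functor.Full.of_iso (nerveIso I).symm
  have := Functor.Faithful.of_iso (nerveIso I).symm
  exact Functor.IsDense.of_fullyFaithful_restrictedULiftYoneda.{u}
    (Functor.FullyFaithful.ofFullyFaithful _)

/-- A weighted limit of nerves of dense functors in `CAT^2` that is the nerve of a full functor is
the nerve of a dense functor. -/
theorem isDense_of_isLimit {J : Type u} [Bicategory.{u, u} J] {W : J ⥤ᵖ Cat.{u, u}}
    {D : J ⥤ᵖ CwA.{u}} [I.Full] {nu : WeightedCone W (D.comp CwA.toArr) ⟨E, Psh A, nerve I⟩}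
    (hnu : nu.IsLimit) : I.IsDense := by
  have (j : J) : ((D.comp CwA.toArr).obj j).functor.Full := nerve_full (D.obj j).incl
  have (j : J) : ((D.comp CwA.toArr).obj j).functor.Faithful := nerve_faithful (D.obj j).incl
  obtain ⟨_, _⟩ := hnu.precomp_full_faithful (ArrCAT.emptyToIdArr ArrCAT.PointCat.{u})
  obtain ⟨_, _⟩ := ArrCAT.full_faithful_of_precomp (Y := ⟨E, Psh A, nerve I⟩)
  have : (nerve I).Full := ‹_›
  have : (nerve I).Faithful := ‹_›
  exact isDense_of_nerve I

end Dense

/-! ### Colimits in the codomain of a limit of arrows -/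

namespace ArrCAT

section Points

variable {Y : ArrCAT.{u}}

/-- An object of the codomain of `Y`, as a 1-cell `(∅ ⟶ 1) ⟶ Y`. -/
def ofPoint (z : Y.cod) : emptyTo PointCat.{u} ⟶ Y := ofBot ((Functor.const _).obj z)

/-- The object of the codomain of `Y` named by a 1-cell `(∅ ⟶ 1) ⟶ Y`. -/
def pt (F : emptyTo PointCat.{u} ⟶ Y) : Y.cod := (Hom.bot F).obj point

/-- The morphism of the codomain of `Y` named by a 2-cell between 1-cells `(∅ ⟶ 1) ⟶ Y`. -/
def pt₂ {F G : emptyTo PointCat.{u} ⟶ Y} (β : F ⟶ G) : pt F ⟶ pt G := (Hom₂.bot β).app point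

/-- The 2-cell between 1-cells `(∅ ⟶ 1) ⟶ Y` named by a morphism of the codomain of `Y`. -/
def ofPoint₂ {F G : emptyTo PointCat.{u} ⟶ Y} (n : pt F ⟶ pt G) : F ⟶ G :=
  ofBot₂
    { app := fun _ => n
      naturality := fun _ _ _ => ((congrArg (· ≫ n) ((Hom.bot F).map_id point)).trans
        (Category.id_comp n)).trans ((congrArg (n ≫ ·) ((Hom.bot G).map_id point)).trans
          (Category.comp_id n)).symm }

theorem pt_hom_ext {F G : emptyTo PointCat.{u} ⟶ Y} {β γ : F ⟶ G} (h : pt₂ β = pt₂ γ) : β = γ :=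
  emptyTo_hom_ext fun _ => h

/-- Invertible 2-cells between 1-cells `(∅ ⟶ 1) ⟶ Y` are named by isomorphisms. -/
def ofPointIso {F G : emptyTo PointCat.{u} ⟶ Y} (n : pt F ≅ pt G) : F ≅ G where
  hom := ofPoint₂ n.hom
  inv := ofPoint₂ n.inv
  hom_inv_id := pt_hom_ext n.hom_inv_id
  inv_hom_id := pt_hom_ext n.inv_hom_id

instance isIso_pt₂ {F G : emptyTo PointCat.{u} ⟶ Y} (β : F ⟶ G) [IsIso β] : IsIso (pt₂ β) :=
  ⟨pt₂ (inv β), congrArg (fun ξ : F ⟶ F => pt₂ ξ) (IsIso.hom_inv_id β),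
    congrArg (fun ξ : G ⟶ G => pt₂ ξ) (IsIso.inv_hom_id β)⟩

theorem isIso_of_pt₂ {F G : emptyTo PointCat.{u} ⟶ Y} (β : F ⟶ G) [IsIso (pt₂ β)] : IsIso β :=
  ⟨ofPoint₂ (inv (pt₂ β)), pt_hom_ext (IsIso.hom_inv_id (pt₂ β)),
    pt_hom_ext (IsIso.inv_hom_id (pt₂ β))⟩

end Points

section Legs

universe w v

variable {J : Type u} [Bicategory.{u, u} J] {W : J ⥤ᵖ Cat.{w, v}} {D : J ⥤ᵖ ArrCAT.{u}}
  {X : ArrCAT.{u}} (κ : WeightedCone W D X)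

/-- The lower component of a leg of a weighted cone in `CAT^2`. -/
abbrev legBot (j : J) (a : W.obj j) : X.cod ⥤ (D.obj j).cod := Hom.bot ((κ.leg j).obj a)

/-- The lower component of the action of a leg of a weighted cone in `CAT^2` on morphisms of the
weight. -/
abbrev legBotMap (j : J) {a b : W.obj j} (t : a ⟶ b) : legBot κ j a ⟶ legBot κ j b :=
  Hom₂.bot ((κ.leg j).map t)

/-- The lower component of a structure 2-cell of a weighted cone in `CAT^2`. -/
def legSquare {i j : J} (f : i ⟶ j) (a : W.obj i) :
    legBot κ i a ⋙ Hom.bot (D.map f) ≅ legBot κ j ((W.map f).toFunctor.obj a) where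
  hom := Hom₂.bot (κ.square f a).hom
  inv := Hom₂.bot (κ.square f a).inv
  hom_inv_id := congrArg Hom₂.bot (κ.square f a).hom_inv_id
  inv_hom_id := congrArg Hom₂.bot (κ.square f a).inv_hom_id

theorem legSquare_natural {i j : J} (f : i ⟶ j) {a b : W.obj i} (t : a ⟶ b) (x : X.cod) :
    (Hom.bot (D.map f)).map ((legBotMap κ i t).app x) ≫ (legSquare κ f b).hom.app x =
      (legSquare κ f a).hom.app x ≫ (legBotMap κ j ((W.map f).toFunctor.map t)).app x :=
  congrArg (fun ξ => (Hom₂.bot ξ).app x) (κ.square_natural f t)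

theorem legSquare_map₂ {i j : J} {f g : i ⟶ j} (θ : f ⟶ g) (a : W.obj i) (x : X.cod) :
    (Hom₂.bot (D.map₂ θ)).app ((legBot κ i a).obj x) ≫ (legSquare κ g a).hom.app x =
      (legSquare κ f a).hom.app x ≫ (legBotMap κ j ((W.map₂ θ).toNatTrans.app a)).app x :=
  congrArg (fun ξ => (Hom₂.bot ξ).app x) (κ.square_map₂ θ a)

variable (D) in
/-- The lower component of the unit comparison of a pseudofunctor to `CAT^2`. -/
def idBot (i : J) : Hom.bot (D.map (𝟙 i)) ⟶ 𝟭 (D.obj i).cod := Hom₂.bot (D.mapId i).hom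

variable (D) in
/-- The lower component of the composition comparison of a pseudofunctor to `CAT^2`. -/
def compBot {i j k : J} (f : i ⟶ j) (g : j ⟶ k) :
    Hom.bot (D.map (f ≫ g)) ⟶ Hom.bot (D.map f) ⋙ Hom.bot (D.map g) :=
  Hom₂.bot (D.mapComp f g).hom

/-- The unit comparison of the weight at `a`. -/
abbrev weightId (W : J ⥤ᵖ Cat.{w, v}) (i : J) (a : W.obj i) :
    (W.map (𝟙 i)).toFunctor.obj a ⟶ a := (W.mapId i).hom.toNatTrans.app a

/-- The composition comparison of the weight at `a`. -/
abbrev weightComp (W : J ⥤ᵖ Cat.{w, v}) {i j k : J} (f : i ⟶ j) (g : j ⟶ k) (a : W.obj i) :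
    (W.map (f ≫ g)).toFunctor.obj a ⟶ (W.map g).toFunctor.obj ((W.map f).toFunctor.obj a) :=
  (W.mapComp f g).hom.toNatTrans.app a

theorem legSquare_id (i : J) (a : W.obj i) (x : X.cod) :
    (legSquare κ (𝟙 i) a).hom.app x ≫ (legBotMap κ i (weightId W i a)).app x =
      (idBot D i).app ((legBot κ i a).obj x) :=
  (congrArg (fun ξ => (Hom₂.bot ξ).app x) (κ.square_id i a)).trans (Category.comp_id _)

theorem legSquare_comp {i j k : J} (f : i ⟶ j) (g : j ⟶ k) (a : W.obj i) (x : X.cod) :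
    (legSquare κ (f ≫ g) a).hom.app x ≫ (legBotMap κ k (weightComp W f g a)).app x =
      (compBot D f g).app ((legBot κ i a).obj x) ≫
        (Hom.bot (D.map g)).map ((legSquare κ f a).hom.app x) ≫
          (legSquare κ g ((W.map f).toFunctor.obj a)).hom.app x :=
  (congrArg (fun ξ => (Hom₂.bot ξ).app x) (κ.square_comp f g a)).trans
    (congrArg (_ ≫ ·) (Category.id_comp _))

variable {κ}

/-- Objects of the codomain are 1-cells out of `∅ ⟶ 1`, so the restriction functor at that arrow
describes the morphisms of the codomain by their images under the legs. -/
theorem legBot_jointly_faithful (hκ : κ.IsLimit) {z z' : X.cod} {φ ψ : z ⟶ z'}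
    (h : ∀ j a, (legBot κ j a).map φ = (legBot κ j a).map ψ) : φ = ψ := by
  have := hκ (emptyTo PointCat.{u})
  have h' := (κ.restriction (emptyTo PointCat.{u})).map_injective
    (X := ofPoint z) (Y := ofPoint z') (a₁ := ofPoint₂ φ) (a₂ := ofPoint₂ ψ)
    (WeightedCone.hom_ext fun j a => pt_hom_ext (h j a))
  exact congrArg (fun β : ofPoint z ⟶ ofPoint z' => pt₂ β) h'

theorem exists_map_legBot_eq (hκ : κ.IsLimit) {F G : emptyTo PointCat.{u} ⟶ X}
    (m : κ.restrict F ⟶ κ.restrict G) :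
    ∃ φ : pt F ⟶ pt G, ∀ j a, (legBot κ j a).map φ = pt₂ ((WeightedCone.Hom.app m j).app a) := by
  have := hκ (emptyTo PointCat.{u})
  obtain ⟨β, hβ⟩ := (κ.restriction (emptyTo PointCat.{u})).map_surjective m
  exact ⟨pt₂ β, fun j a => congrArg
    (fun m : κ.restrict F ⟶ κ.restrict G => pt₂ ((WeightedCone.Hom.app m j).app a)) hβ⟩

theorem legBot_jointly_reflects_isIso (hκ : κ.IsLimit) {z z' : X.cod} (φ : z ⟶ z')
    (h : ∀ j a, IsIso ((legBot κ j a).map φ)) : IsIso φ := by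
  have := hκ (emptyTo PointCat.{u})
  let β : ofPoint z ⟶ ofPoint z' := ofPoint₂ φ
  have : IsIso ((κ.restriction (emptyTo PointCat.{u})).map β) :=
    WeightedCone.isIso_of_components _ fun j a => by
      have : IsIso (pt₂ (β ▷ (κ.leg j).obj a)) := h j a
      exact isIso_of_pt₂ (β ▷ (κ.leg j).obj a)
  have : IsIso β := isIso_of_reflects_iso β (κ.restriction (emptyTo PointCat.{u}))
  exact isIso_pt₂ β

end Legs

section Colimits

universe w v

variable {J : Type u} [Bicategory.{u, u} J] {W : J ⥤ᵖ Cat.{w, v}} {D : J ⥤ᵖ ArrCAT.{u}}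
  {X : ArrCAT.{u}} (κ : WeightedCone W D X) {K : Type u} [SmallCategory K]
  [∀ j, HasColimitsOfShape K (D.obj j).cod]
  [∀ {i j : J} (f : i ⟶ j), PreservesColimitsOfShape K (Hom.bot (D.map f))]

/-- The comparison, along a 1-cell of the diagram, of the colimits of the images of `d` under the
lower components of the legs of a cone. -/
noncomputable def colimitSquare (d : K ⥤ X.cod) {i j : J} (f : i ⟶ j) (a : W.obj i) :
    (Hom.bot (D.map f)).obj (colimit (d ⋙ legBot κ i a)) ≅
      colimit (d ⋙ legBot κ j ((W.map f).toFunctor.obj a)) :=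
  preservesColimitIso (Hom.bot (D.map f)) (d ⋙ legBot κ i a) ≪≫
    HasColimit.isoOfNatIso (Functor.isoWhiskerLeft d (legSquare κ f a))

theorem map_ι_colimitSquare (d : K ⥤ X.cod) {i j : J} (f : i ⟶ j) (a : W.obj i) (k : K) :
    (Hom.bot (D.map f)).map (colimit.ι (d ⋙ legBot κ i a) k) ≫ (colimitSquare κ d f a).hom =
      (legSquare κ f a).hom.app (d.obj k) ≫
        colimit.ι (d ⋙ legBot κ j ((W.map f).toFunctor.obj a)) k := by
  rw [colimitSquare, Iso.trans_hom, ι_preservesColimitIso_hom_assoc]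
  exact HasColimit.isoOfNatIso_ι_hom _ k

theorem map_colimit_hom_ext {i j : J} (f : i ⟶ j) {d : K ⥤ (D.obj i).cod} {z : (D.obj j).cod}
    {m n : (Hom.bot (D.map f)).obj (colimit d) ⟶ z}
    (h : ∀ k, (Hom.bot (D.map f)).map (colimit.ι d k) ≫ m =
      (Hom.bot (D.map f)).map (colimit.ι d k) ≫ n) : m = n :=
  (isColimitOfPreserves (Hom.bot (D.map f)) (colimit.isColimit d)).hom_ext h

theorem ι_colimMap_whiskerLeft {C C' : Type (u + 1)} [LargeCategory.{u} C] [LargeCategory.{u} C']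
    [HasColimitsOfShape K C'] (d : K ⥤ C) {F G : C ⥤ C'} (α : F ⟶ G) (k : K) :
    colimit.ι (d ⋙ F) k ≫ colimMap (Functor.whiskerLeft d α) =
      α.app (d.obj k) ≫ colimit.ι (d ⋙ G) k :=
  ι_colimMap _ _

/-- The colimits of the images of `d` under the lower components of the legs of a weighted cone
form a weighted cone of points, since the 1-cells of the diagram preserve them. -/
noncomputable def colimitCone (d : K ⥤ X.cod) : WeightedCone W D (emptyTo PointCat.{u}) where
  leg j :=
    { obj := fun a => ofPoint (colimit (d ⋙ legBot κ j a))
      map := fun t => ofPoint₂ (colimMap (Functor.whiskerLeft d (legBotMap κ j t)))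
      map_id := fun a => pt_hom_ext (colimit.hom_ext fun k => by
        change colimit.ι (d ⋙ legBot κ j a) k ≫ colimMap (Functor.whiskerLeft d _) =
          colimit.ι (d ⋙ legBot κ j a) k ≫ 𝟙 (colimit (d ⋙ legBot κ j a))
        rw [ι_colimMap_whiskerLeft, Category.comp_id]
        have h : legBotMap κ j (𝟙 a) = 𝟙 _ := congrArg Hom₂.bot ((κ.leg j).map_id a)
        rw [h]
        exact Category.id_comp _)
      map_comp := fun {a b c} t t' => pt_hom_ext (colimit.hom_ext fun k => by
        change colimit.ι (d ⋙ legBot κ j a) k ≫ colimMap (Functor.whiskerLeft d _) =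
          colimit.ι (d ⋙ legBot κ j a) k ≫ colimMap (Functor.whiskerLeft d (legBotMap κ j t)) ≫
            colimMap (Functor.whiskerLeft d (legBotMap κ j t'))
        have h : legBotMap κ j (t ≫ t') = legBotMap κ j t ≫ legBotMap κ j t' :=
          congrArg Hom₂.bot ((κ.leg j).map_comp t t')
        rw [ι_colimMap_whiskerLeft, reassoc_of% (ι_colimMap_whiskerLeft d (legBotMap κ j t) k),
          ι_colimMap_whiskerLeft, h, NatTrans.comp_app, Category.assoc]) }
  square f a := ofPointIso (colimitSquare κ d f a)
  square_natural {i j} f a b t := pt_hom_ext (map_colimit_hom_ext f fun k => by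
    change (Hom.bot (D.map f)).map (colimit.ι (d ⋙ legBot κ i a) k) ≫
        (Hom.bot (D.map f)).map (colimMap (Functor.whiskerLeft d (legBotMap κ i t))) ≫
          (colimitSquare κ d f b).hom =
      (Hom.bot (D.map f)).map (colimit.ι (d ⋙ legBot κ i a) k) ≫ (colimitSquare κ d f a).hom ≫
        colimMap (Functor.whiskerLeft d (legBotMap κ j ((W.map f).toFunctor.map t)))
    rw [← Functor.map_comp_assoc, ι_colimMap_whiskerLeft, Functor.map_comp_assoc,
      map_ι_colimitSquare, reassoc_of% (map_ι_colimitSquare κ d f a k), ι_colimMap_whiskerLeft,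
      reassoc_of% (legSquare_natural κ f t (d.obj k))])
  square_map₂ {i j f g} θ a := pt_hom_ext (map_colimit_hom_ext f fun k => by
    change (Hom.bot (D.map f)).map (colimit.ι (d ⋙ legBot κ i a) k) ≫
        (Hom₂.bot (D.map₂ θ)).app (colimit (d ⋙ legBot κ i a)) ≫ (colimitSquare κ d g a).hom =
      (Hom.bot (D.map f)).map (colimit.ι (d ⋙ legBot κ i a) k) ≫ (colimitSquare κ d f a).hom ≫
        colimMap (Functor.whiskerLeft d (legBotMap κ j ((W.map₂ θ).toNatTrans.app a)))
    rw [NatTrans.naturality_assoc, map_ι_colimitSquare,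
      reassoc_of% (map_ι_colimitSquare κ d f a k), ι_colimMap_whiskerLeft]
    exact (reassoc_of% (legSquare_map₂ κ θ a (d.obj k))) _)
  square_id i a := pt_hom_ext (map_colimit_hom_ext (𝟙 i) fun k => by
    change (Hom.bot (D.map (𝟙 i))).map (colimit.ι (d ⋙ legBot κ i a) k) ≫
        (colimitSquare κ d (𝟙 i) a).hom ≫
          colimMap (Functor.whiskerLeft d (legBotMap κ i (weightId W i a))) =
      (Hom.bot (D.map (𝟙 i))).map (colimit.ι (d ⋙ legBot κ i a) k) ≫
        (idBot D i).app (colimit (d ⋙ legBot κ i a)) ≫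
          𝟙 ((𝟭 (D.obj i).cod).obj (colimit (d ⋙ legBot κ i a)))
    have h : (Hom.bot (D.map (𝟙 i))).map (colimit.ι (d ⋙ legBot κ i a) k) ≫
        (idBot D i).app (colimit (d ⋙ legBot κ i a)) =
          (idBot D i).app ((legBot κ i a).obj (d.obj k)) ≫ colimit.ι (d ⋙ legBot κ i a) k :=
      (idBot D i).naturality _
    rw [Category.comp_id, h, reassoc_of% (map_ι_colimitSquare κ d (𝟙 i) a k),
      ι_colimMap_whiskerLeft]
    exact (reassoc_of% (legSquare_id κ i a (d.obj k))) _)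
  square_comp {i j l} f g a := pt_hom_ext (map_colimit_hom_ext (f ≫ g) fun k => by
    change (Hom.bot (D.map (f ≫ g))).map (colimit.ι (d ⋙ legBot κ i a) k) ≫
        (colimitSquare κ d (f ≫ g) a).hom ≫
          colimMap (Functor.whiskerLeft d (legBotMap κ l (weightComp W f g a))) =
      (Hom.bot (D.map (f ≫ g))).map (colimit.ι (d ⋙ legBot κ i a) k) ≫
        (compBot D f g).app (colimit (d ⋙ legBot κ i a)) ≫
          𝟙 ((Hom.bot (D.map f) ⋙ Hom.bot (D.map g)).obj (colimit (d ⋙ legBot κ i a))) ≫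
            (Hom.bot (D.map g)).map (colimitSquare κ d f a).hom ≫
              (colimitSquare κ d g ((W.map f).toFunctor.obj a)).hom
    have h : (Hom.bot (D.map (f ≫ g))).map (colimit.ι (d ⋙ legBot κ i a) k) ≫
        (compBot D f g).app (colimit (d ⋙ legBot κ i a)) =
          (compBot D f g).app ((legBot κ i a).obj (d.obj k)) ≫
            (Hom.bot (D.map g)).map ((Hom.bot (D.map f)).map (colimit.ι (d ⋙ legBot κ i a) k)) :=
      (compBot D f g).naturality _
    rw [Category.id_comp, reassoc_of% h, reassoc_of% (map_ι_colimitSquare κ d (f ≫ g) a k),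
      ι_colimMap_whiskerLeft, ← Functor.map_comp_assoc, map_ι_colimitSquare,
      Functor.map_comp_assoc, map_ι_colimitSquare]
    exact (reassoc_of% (legSquare_comp κ f g a (d.obj k))) _)

/-- The comparison of the colimits of images with the image of the colimit, as a morphism of
weighted cones. -/
noncomputable def colimitConePost [HasColimitsOfShape K X.cod] (d : K ⥤ X.cod) :
    colimitCone κ d ⟶ κ.restrict (ofPoint (colimit d)) where
  app j :=
    { app := fun a => ofPoint₂ (colimit.post d (legBot κ j a))
      naturality := fun a b t => pt_hom_ext (colimit.hom_ext fun k => by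
        change colimit.ι (d ⋙ legBot κ j a) k ≫
            colimMap (Functor.whiskerLeft d (legBotMap κ j t)) ≫ colimit.post d (legBot κ j b) =
          colimit.ι (d ⋙ legBot κ j a) k ≫ colimit.post d (legBot κ j a) ≫
            (legBotMap κ j t).app (colimit d)
        rw [reassoc_of% (ι_colimMap_whiskerLeft d (legBotMap κ j t) k), colimit.ι_post,
          colimit.ι_post_assoc, NatTrans.naturality]) }
  comm {i j} f a := pt_hom_ext (map_colimit_hom_ext f fun k => by
    change (Hom.bot (D.map f)).map (colimit.ι (d ⋙ legBot κ i a) k) ≫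
        (colimitSquare κ d f a).hom ≫ colimit.post d (legBot κ j ((W.map f).toFunctor.obj a)) =
      (Hom.bot (D.map f)).map (colimit.ι (d ⋙ legBot κ i a) k) ≫
        (Hom.bot (D.map f)).map (colimit.post d (legBot κ i a)) ≫
          𝟙 ((Hom.bot (D.map f)).obj ((legBot κ i a).obj (colimit d))) ≫
            (legSquare κ f a).hom.app (colimit d)
    rw [Category.id_comp, ← Functor.map_comp_assoc, colimit.ι_post,
      reassoc_of% (map_ι_colimitSquare κ d f a k), colimit.ι_post]
    exact ((legSquare κ f a).hom.naturality _).symm)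

/-- The coprojections into the colimits of images, as morphisms of weighted cones. -/
noncomputable def colimitConeι (d : K ⥤ X.cod) (k : K) :
    κ.restrict (ofPoint (d.obj k)) ⟶ colimitCone κ d where
  app j :=
    { app := fun a => ofPoint₂ (colimit.ι (d ⋙ legBot κ j a) k)
      naturality := fun a b t => pt_hom_ext
        (ι_colimMap_whiskerLeft d (legBotMap κ j t) k).symm }
  comm {i j} f a := pt_hom_ext (by
    change (𝟙 ((Hom.bot (D.map f)).obj ((legBot κ i a).obj (d.obj k))) ≫
        (legSquare κ f a).hom.app (d.obj k)) ≫
          colimit.ι (d ⋙ legBot κ j ((W.map f).toFunctor.obj a)) k =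
      (Hom.bot (D.map f)).map (colimit.ι (d ⋙ legBot κ i a) k) ≫ (colimitSquare κ d f a).hom
    rw [Category.id_comp, map_ι_colimitSquare])

variable {κ}

/-- The lower components of the legs of a limit cone preserve the colimits that the 1-cells of the
diagram preserve: the weighted cone of the colimits of the images of `d` is the image of some
object `z` of the vertex, and the comparison maps between `z` and `colimit d` are mutually
inverse. -/
theorem preservesColimitsOfShape_legBot (hκ : κ.IsLimit) [HasColimitsOfShape K X.cod] (j : J)
    (a : W.obj j) : PreservesColimitsOfShape K (legBot κ j a) := by
  refine ⟨fun {d} => ?_⟩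
  have := hκ (emptyTo PointCat.{u})
  -- As the cone is a limit, `colimitCone` comes from an object `z`, and the morphisms of cones
  -- `colimitConePost` and `colimitConeι` come from morphisms `m` and `s k` of the vertex.
  obtain ⟨z, t, ⟨m, hm⟩, hs⟩ : ∃ (z : X.cod)
      (t : ∀ (j : J) (a : W.obj j), (legBot κ j a).obj z ≅ colimit (d ⋙ legBot κ j a)),
      (∃ m : z ⟶ colimit d, ∀ j a,
        (legBot κ j a).map m = (t j a).hom ≫ colimit.post d (legBot κ j a)) ∧
      ∀ k, ∃ s : d.obj k ⟶ z, ∀ j a,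
        (legBot κ j a).map s = colimit.ι (d ⋙ legBot κ j a) k ≫ (t j a).inv := by
    let G := (κ.restriction (emptyTo PointCat.{u})).objPreimage (colimitCone κ d)
    let θ : κ.restrict G ≅ colimitCone κ d :=
      (κ.restriction (emptyTo PointCat.{u})).objObjPreimageIso (colimitCone κ d)
    exact ⟨pt G, fun j a =>
      { hom := pt₂ (WeightedCone.isoApp θ j a).hom
        inv := pt₂ (WeightedCone.isoApp θ j a).inv
        hom_inv_id := congrArg (fun ξ : G ≫ (κ.leg j).obj a ⟶ G ≫ (κ.leg j).obj a => pt₂ ξ)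
          (WeightedCone.isoApp θ j a).hom_inv_id
        inv_hom_id := congrArg (fun ξ : ofPoint (colimit (d ⋙ legBot κ j a)) ⟶
          ofPoint (colimit (d ⋙ legBot κ j a)) => pt₂ ξ) (WeightedCone.isoApp θ j a).inv_hom_id },
      exists_map_legBot_eq hκ (G := ofPoint (colimit d)) (θ.hom ≫ colimitConePost κ d),
      fun k => exists_map_legBot_eq hκ (F := ofPoint (d.obj k)) (colimitConeι κ d k ≫ θ.inv)⟩
  choose s hs using hs
  let c : Cocone d :=
    { pt := z
      ι :=
        { app := s
          naturality := fun k k' f => by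
            refine legBot_jointly_faithful hκ fun j a => ?_
            have h := colimit.w (d ⋙ legBot κ j a) f
            change (legBot κ j a).map (d.map f) ≫ _ = _ at h
            change (legBot κ j a).map (d.map f ≫ s k') = (legBot κ j a).map (s k ≫ 𝟙 z)
            rw [Category.comp_id, Functor.map_comp, hs, hs, reassoc_of% h] } }
  let n : colimit d ⟶ z := colimit.desc d c
  have hn (k : K) : colimit.ι d k ≫ n = s k := colimit.ι_desc c k
  have hsm (k : K) : s k ≫ m = colimit.ι d k := by
    refine legBot_jointly_faithful hκ fun j a => ?_
    rw [Functor.map_comp, hs, hm, Category.assoc, Iso.inv_hom_id_assoc, colimit.ι_post]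
  have hnm : n ≫ m = 𝟙 _ := colimit.hom_ext fun k => by
    rw [reassoc_of% (hn k), hsm, Category.comp_id]
  have hmn : m ≫ n = 𝟙 _ := by
    refine legBot_jointly_faithful hκ fun j a => ?_
    rw [← cancel_epi (t j a).inv]
    refine colimit.hom_ext fun k => ?_
    rw [← reassoc_of% (hs k j a), ← reassoc_of% (hs k j a), ← Functor.map_comp,
      ← Functor.map_comp, reassoc_of% (hsm k), hn, Category.comp_id]
  have : IsIso m := ⟨n, hmn, hnm⟩
  have hp : colimit.post d (legBot κ j a) = (t j a).inv ≫ (legBot κ j a).map m := by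
    rw [hm, Iso.inv_hom_id_assoc]
  have : IsIso (colimit.post d (legBot κ j a)) := by
    rw [hp]
    infer_instance
  exact preservesColimit_of_isIso_post _ _

/-- A functor into the codomain of the vertex of a limit cone preserves colimits if its composites
with the lower components of the legs do. -/
theorem preservesColimitsOfShape_of_comp_legBot (hκ : κ.IsLimit) [HasColimitsOfShape K X.cod]
    {C : Type (u + 1)} [LargeCategory.{u} C] [HasColimitsOfShape K C] (G : C ⥤ X.cod)
    (hG : ∀ j a, PreservesColimitsOfShape K (G ⋙ legBot κ j a)) :
    PreservesColimitsOfShape K G := by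
  refine ⟨fun {d} => ?_⟩
  have : IsIso (colimit.post d G) := by
    refine legBot_jointly_reflects_isIso hκ _ fun j a => ?_
    have := preservesColimitsOfShape_legBot (K := K) hκ j a
    have := hG j a
    have h := colimit.post_post d G (legBot κ j a)
    have h₁ : IsIso (colimit.post d (G ⋙ legBot κ j a)) := inferInstance
    have h₂ : IsIso (colimit.post (d ⋙ G) (legBot κ j a)) := inferInstance
    have h₃ : IsIso (colimit.post (d ⋙ G) (legBot κ j a) ≫
        (legBot κ j a).map (colimit.post d G)) := by
      rw [h]
      exact h₁
    exact IsIso.of_isIso_comp_left (colimit.post (d ⋙ G) (legBot κ j a)) _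
  exact preservesColimit_of_isIso_post _ _

end Colimits

end ArrCAT

/-! ### Lifting weighted cones of nerves -/

namespace ArrCAT

variable {C : Type (u + 1)} [LargeCategory.{u} C] {Y : ArrCAT.{u}}

/-- Invertible 2-cells between 1-cells `(∅ ⟶ C) ⟶ Y` are isomorphisms of lower components. -/
def ofBotIso {F G : emptyTo C ⟶ Y} (n : Hom.bot F ≅ Hom.bot G) : F ≅ G where
  hom := ofBot₂ n.hom
  inv := ofBot₂ n.inv
  hom_inv_id := emptyTo_hom_ext fun c => n.hom_inv_id_app c
  inv_hom_id := emptyTo_hom_ext fun c => n.inv_hom_id_app c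

/-- The 1-cell from the identity arrow of `C` to `Y` given by a functor to the domain of `Y`. -/
def ofTop (F : C ⥤ Y.dom) : idArr C ⟶ Y where
  top := F
  bot := F ⋙ Y.functor
  square _ := Iso.refl _
  square_natural _ := (Category.comp_id _).trans (Category.id_comp _).symm

/-- Invertible 2-cells between 1-cells out of the identity arrow of `C` are isomorphisms of upper
components. -/
def ofTopIso {F G : idArr C ⟶ Y} (n : Hom.top F ≅ Hom.top G) : F ≅ G where
  hom := ofTop₂ n.hom
  inv := ofTop₂ n.inv
  hom_inv_id := idArr_hom_ext fun c => n.hom_inv_id_app c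
  inv_hom_id := idArr_hom_ext fun c => n.inv_hom_id_app c

/-- The lower component of an invertible 2-cell. -/
def botIso {X Y : ArrCAT.{u}} {F G : X ⟶ Y} (e : F ≅ G) : Hom.bot F ≅ Hom.bot G where
  hom := Hom₂.bot e.hom
  inv := Hom₂.bot e.inv
  hom_inv_id := congrArg Hom₂.bot e.hom_inv_id
  inv_hom_id := congrArg Hom₂.bot e.inv_hom_id

end ArrCAT

namespace CwA

open ArrCAT (legBot)

section Locally

variable {X Y : CwA.{u}}

instance toArr_mapFunctor_faithful : (toArr.mapFunctor X Y).Faithful where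
  map_injective {K L α β} h := Hom₂.ext (by
    have h' : ArrCAT.Hom₂.top (squareMap₂ α) = ArrCAT.Hom₂.top (squareMap₂ β) :=
      congrArg (fun ξ : toSquare K ⟶ toSquare L => ArrCAT.Hom₂.top ξ) h
    rwa [squareMap₂_top, squareMap₂_top] at h')

instance toArr_mapFunctor_full : (toArr.mapFunctor X Y).Full where
  map_surjective {K L} β := ⟨⟨ArrCAT.Hom₂.top β⟩, by
    apply toSquare_ext
    intro e
    change (ArrCAT.Hom₂.top (squareMap₂ _)).app e = _
    rw [squareMap₂_top]⟩

/-- The upper functor of a pseudo-commuting square of nerves with cocontinuous lower functor is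
arities-respecting. -/
def ofSquare (F : X.arr ⟶ Y.arr) (hF : PreservesColimitsOfSize.{u, u} (ArrCAT.Hom.bot F)) :
    X ⟶ Y where
  functor := ArrCAT.Hom.top F
  respects := respectsArities_of_square _ (ArrCAT.Hom.bot F)
    (NatIso.ofComponents (ArrCAT.Hom.square F) (ArrCAT.Hom.square_natural F))

/-- A pseudo-commuting square of nerves with cocontinuous lower functor is determined by its upper
functor. -/
noncomputable def toSquareOfSquare (F : X.arr ⟶ Y.arr)
    (hF : PreservesColimitsOfSize.{u, u} (ArrCAT.Hom.bot F)) :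
    toArr.map (ofSquare F hF) ≅ F :=
  X.liftIso (F := toSquare (ofSquare F hF)) (G := F) (extension_cocontinuous _) hF
    (Iso.refl (ArrCAT.Hom.top F))

theorem toSquareOfSquare_hom_top (F : X.arr ⟶ Y.arr)
    (hF : PreservesColimitsOfSize.{u, u} (ArrCAT.Hom.bot F)) :
    ArrCAT.Hom₂.top (toSquareOfSquare F hF).hom = 𝟙 (ArrCAT.Hom.top F) :=
  lift₂_top X (F := toSquare (ofSquare F hF)) (G := F) (extension_cocontinuous _) _

end Locally

section Lift

variable {J : Type u} [Bicategory.{u, u} J] {W : J ⥤ᵖ Cat.{u, u}} {D : J ⥤ᵖ CwA.{u}}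

theorem comp_toArr_mapId_hom_top (i : J) :
    ArrCAT.Hom₂.top ((D.comp toArr).mapId i).hom = Hom₂.natTrans (D.mapId i).hom := by
  change ArrCAT.Hom₂.top (squareMap₂ (D.mapId i).hom) ≫
    ArrCAT.Hom₂.top (squareId (D.obj i)).hom = _
  rw [squareMap₂_top, squareId_hom_top]
  exact Category.comp_id _

theorem comp_toArr_mapComp_hom_top {i j k : J} (f : i ⟶ j) (g : j ⟶ k) :
    ArrCAT.Hom₂.top ((D.comp toArr).mapComp f g).hom = Hom₂.natTrans (D.mapComp f g).hom := by
  change ArrCAT.Hom₂.top (squareMap₂ (D.mapComp f g).hom) ≫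
    ArrCAT.Hom₂.top (squareComp (D.map f) (D.map g)).hom = _
  rw [squareMap₂_top, squareComp_hom_top]
  exact Category.comp_id _

theorem comp_toArr_map₂_top {i j : J} {f g : i ⟶ j} (θ : f ⟶ g) :
    ArrCAT.Hom₂.top ((D.comp toArr).map₂ θ) = Hom₂.natTrans (D.map₂ θ) :=
  squareMap₂_top _

variable {X : CwA.{u}} (nu : WeightedCone W (D.comp toArr) X.arr)
  (h : ∀ j a, PreservesColimitsOfSize.{u, u} (legBot nu j a))

/-- A weighted cone of nerves whose legs have cocontinuous lower functors comes from a weighted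
cone of categories with arities. -/
def liftCone : WeightedCone W D X where
  leg j :=
    { obj := fun a => ofSquare ((nu.leg j).obj a) (h j a)
      map := fun t => ⟨ArrCAT.Hom₂.top ((nu.leg j).map t)⟩
      map_id := fun a => Hom₂.ext (congrArg ArrCAT.Hom₂.top ((nu.leg j).map_id a))
      map_comp := fun t t' => Hom₂.ext (congrArg ArrCAT.Hom₂.top ((nu.leg j).map_comp t t')) }
  square f a :=
    { hom := ⟨ArrCAT.Hom₂.top (nu.square f a).hom⟩
      inv := ⟨ArrCAT.Hom₂.top (nu.square f a).inv⟩
      hom_inv_id := Hom₂.ext (congrArg ArrCAT.Hom₂.top (nu.square f a).hom_inv_id)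
      inv_hom_id := Hom₂.ext (congrArg ArrCAT.Hom₂.top (nu.square f a).inv_hom_id) }
  square_natural f a b t := Hom₂.ext (congrArg ArrCAT.Hom₂.top (nu.square_natural f t))
  square_map₂ {i j f g} θ a := Hom₂.ext (by
    have h := congrArg ArrCAT.Hom₂.top (nu.square_map₂ θ a)
    change Functor.whiskerLeft _ (ArrCAT.Hom₂.top ((D.comp toArr).map₂ θ)) ≫ _ = _ at h
    rw [comp_toArr_map₂_top] at h
    exact h)
  square_id i a := Hom₂.ext (by
    have h := congrArg ArrCAT.Hom₂.top (nu.square_id i a)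
    change _ = Functor.whiskerLeft _ (ArrCAT.Hom₂.top ((D.comp toArr).mapId i).hom) ≫ _ at h
    rw [comp_toArr_mapId_hom_top] at h
    exact h)
  square_comp {i j k} f g a := Hom₂.ext (by
    have h := congrArg ArrCAT.Hom₂.top (nu.square_comp f g a)
    change _ = Functor.whiskerLeft _ (ArrCAT.Hom₂.top ((D.comp toArr).mapComp f g).hom) ≫ _ at h
    rw [comp_toArr_mapComp_hom_top] at h
    exact h)

/-- The image in `CAT^2` of a lifted cone is the cone it was lifted from. -/
noncomputable def mapLiftCone : (liftCone nu h).map toArr ≅ nu :=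
  WeightedCone.isoMk (fun j a => toSquareOfSquare ((nu.leg j).obj a) (h j a))
    (fun j a b t => X.hom₂_unique (hF := extension_cocontinuous _)
      ((congrArg₂ (fun α β => α ≫ β) (squareMap₂_top (((liftCone nu h).leg j).map t))
          (toSquareOfSquare_hom_top ((nu.leg j).obj b) (h j b))).trans
        ((Category.comp_id _).trans ((Category.id_comp _).symm.trans
          (congrArg (fun α => α ≫ ArrCAT.Hom₂.top ((nu.leg j).map t))
            (toSquareOfSquare_hom_top ((nu.leg j).obj a) (h j a)).symm)))))
    (fun {i j} f a => X.hom₂_unique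
      (hF := comp_cocontinuous (((liftCone nu h).leg i).obj a) (D.map f)) (by
        refine (congrArg₂ (fun α β => α ≫ β)
          (congrArg₂ (fun α β => α ≫ β) (squareComp_inv_top _ _) (squareMap₂_top _))
          (toSquareOfSquare_hom_top _ (h j ((W.map f).toFunctor.obj a)))).trans ?_
        refine ((Category.comp_id _).trans (Category.id_comp _)).trans ?_
        refine Eq.trans ?_ (congrArg (fun α => Functor.whiskerRight α (Hom.functor (D.map f)) ≫
          ArrCAT.Hom₂.top (nu.square f a).hom) (toSquareOfSquare_hom_top _ (h i a)).symm)
        refine Eq.trans ?_ (congrArg (fun α => α ≫ ArrCAT.Hom₂.top (nu.square f a).hom)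
          (Functor.whiskerRight_id' (Hom.functor (D.map f))).symm)
        exact (Category.id_comp _).symm))

end Lift

end CwA

/-! ### Limits of categories with arities -/

namespace CwA

open ArrCAT (legBot)

section Limit

variable {J : Type u} [Bicategory.{u, u} J] {W : J ⥤ᵖ Cat.{u, u}} {D : J ⥤ᵖ CwA.{u}}

/-- The lower components of the legs of a limit cone of nerves are cocontinuous. -/
theorem legBot_cocontinuous {E : Type (u + 1)} [LargeCategory.{u} E] {A : Type u}
    [SmallCategory A] {N : E ⥤ Psh A} {nu : WeightedCone W (D.comp toArr) ⟨E, Psh A, N⟩}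
    (hnu : nu.IsLimit) (j : J) (a : W.obj j) :
    PreservesColimitsOfSize.{u, u} (legBot nu j a) := by
  refine ⟨fun {K} _ => ?_⟩
  have (j : J) : HasColimitsOfShape K ((D.comp toArr).obj j).cod :=
    inferInstanceAs (HasColimitsOfShape K (Psh (D.obj j).A))
  have {i j : J} (f : i ⟶ j) :
      PreservesColimitsOfShape K (ArrCAT.Hom.bot ((D.comp toArr).map f)) :=
    (extension_cocontinuous (D.map f).functor).preservesColimitsOfShape
  have : HasColimitsOfShape K (ArrCAT.mk E (Psh A) N).cod :=
    inferInstanceAs (HasColimitsOfShape K (Psh A))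
  exact ArrCAT.preservesColimitsOfShape_legBot hnu j a

/-- The lower components of the legs of a limit cone of nerves jointly detect cocontinuity. -/
theorem cocontinuous_of_comp_legBot {E : Type (u + 1)} [LargeCategory.{u} E] {A : Type u}
    [SmallCategory A] {N : E ⥤ Psh A} {nu : WeightedCone W (D.comp toArr) ⟨E, Psh A, N⟩}
    (hnu : nu.IsLimit) {B : Type u} [SmallCategory B] (G : Psh B ⥤ Psh A)
    (hG : ∀ j a, PreservesColimitsOfSize.{u, u} (G ⋙ legBot nu j a)) :
    PreservesColimitsOfSize.{u, u} G := by
  refine ⟨fun {K} _ => ?_⟩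
  have (j : J) : HasColimitsOfShape K ((D.comp toArr).obj j).cod :=
    inferInstanceAs (HasColimitsOfShape K (Psh (D.obj j).A))
  have {i j : J} (f : i ⟶ j) :
      PreservesColimitsOfShape K (ArrCAT.Hom.bot ((D.comp toArr).map f)) :=
    (extension_cocontinuous (D.map f).functor).preservesColimitsOfShape
  have : HasColimitsOfShape K (ArrCAT.mk E (Psh A) N).cod :=
    inferInstanceAs (HasColimitsOfShape K (Psh A))
  exact ArrCAT.preservesColimitsOfShape_of_comp_legBot hnu G
    fun j a => (hG j a).preservesColimitsOfShape

variable {X : CwA.{u}} {nu : WeightedCone W (D.comp toArr) X.arr}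
  (h : ∀ j a, PreservesColimitsOfSize.{u, u} (legBot nu j a))

/-- The 1-cells into the vertex of a lifted cone are the squares into the vertex of the original
cone whose lower functors are cocontinuous, and cocontinuity can be tested on the legs. -/
theorem isLimit_liftCone (hnu : nu.IsLimit) : (liftCone nu h).IsLimit := fun Y => by
  have (j : J) : ((HomTransform.ofPseudofunctor toArr D Y).functor j).Full :=
    toArr_mapFunctor_full (X := Y) (Y := D.obj j)
  have (j : J) : ((HomTransform.ofPseudofunctor toArr D Y).functor j).Faithful :=
    toArr_mapFunctor_faithful (X := Y) (Y := D.obj j)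
  let S : (Y ⟶ X) ⥤ (toArr.obj Y ⟶ X.arr) := toArr.mapFunctor Y X
  have : S.Full := toArr_mapFunctor_full
  have : S.Faithful := toArr_mapFunctor_faithful
  refine (HomTransform.ofPseudofunctor toArr D Y).isEquivalence_restriction hnu S
    (HomTransform.restrictionMapIso (liftCone nu h) toArr Y ≪≫
      Functor.isoWhiskerLeft S
        (WeightedCone.restrictionIsoOfIso (mapLiftCone nu h) (toArr.obj Y))) fun μ G ξ => ?_
  have hG : PreservesColimitsOfSize.{u, u} (ArrCAT.Hom.bot G) :=
    cocontinuous_of_comp_legBot hnu _ fun j a => by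
      exact @preservesColimits_of_natIso (Psh Y.A) _ (Psh (D.obj j).A) _ _ _
        (ArrCAT.botIso (WeightedCone.isoApp ξ j a)).symm
        (extension_cocontinuous ((μ.leg j).obj a).functor)
  exact ⟨ofSquare G hG, ⟨toSquareOfSquare G hG⟩⟩

end Limit

/-- The shape in which composites of identity structure 2-cells appear in the coherence
conditions. -/
theorem comp_id_map_id_comp_id {C C' : Type (u + 1)} [LargeCategory.{u} C] [LargeCategory.{u} C']
    (G : C ⥤ C') {x : C'} {y : C} (m : x ⟶ G.obj y) : m ≫ 𝟙 _ ≫ G.map (𝟙 y) ≫ 𝟙 _ = m := by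
  simp

section Prof

variable {J : Type u} [Bicategory.{u, u} J] {W : J ⥤ᵖ Cat.{u, u}} (D : J ⥤ᵖ CwA.{u})

/-- Cocontinuous functors between presheaf categories as 1-cells of `CAT^2` out of
`∅ ⟶ Psh B`. -/
def profHom (B : Prof.{u}) (Y : CwA.{u}) :
    (B ⟶ toProf.obj Y) ⥤ (ArrCAT.emptyTo (Psh B.carrier) ⟶ Y.arr) where
  obj P := ArrCAT.ofBot (Y := Y.arr) (Prof.Hom.functor P)
  map α := ArrCAT.ofBot₂ (Prof.Hom₂.natTrans α)
  map_id _ := ArrCAT.emptyTo_hom_ext fun _ => rfl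
  map_comp _ _ := ArrCAT.emptyTo_hom_ext fun _ => rfl

instance (B : Prof.{u}) (Y : CwA.{u}) : (profHom B Y).Faithful where
  map_injective {P Q _ _} h := Prof.Hom₂.ext (congrArg (fun ξ :
    ArrCAT.ofBot (Y := Y.arr) (Prof.Hom.functor P) ⟶
      ArrCAT.ofBot (Y := Y.arr) (Prof.Hom.functor Q) => ArrCAT.Hom₂.bot ξ) h)

instance (B : Prof.{u}) (Y : CwA.{u}) : (profHom B Y).Full where
  map_surjective β := ⟨⟨ArrCAT.Hom₂.bot β⟩, ArrCAT.emptyTo_hom_ext fun _ => rfl⟩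

/-- The inclusion of cocontinuous functors into all functors between presheaf categories, for the
categories of presheaves on the arities of a diagram. -/
noncomputable def profTransform (B : Prof.{u}) :
    HomTransform (D.comp toProf) B (D.comp toArr) (ArrCAT.emptyTo (Psh B.carrier)) where
  functor j := profHom B (D.obj j)
  square _ _ := ArrCAT.ofBotIso (Iso.refl _)
  square_natural _ _ _ _ := ArrCAT.emptyTo_hom_ext fun _ =>
    (Category.comp_id _).trans (Category.id_comp _).symm
  square_map₂ _ _ := ArrCAT.emptyTo_hom_ext fun _ =>
    (Category.comp_id _).trans (Category.id_comp _).symm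
  square_id _ _ := ArrCAT.emptyTo_hom_ext fun _ => Category.id_comp _
  square_comp f g P := ArrCAT.emptyTo_hom_ext fun c =>
    (Category.id_comp _).trans ((Category.comp_id _).trans
      (comp_id_map_id_comp_id (extension (D.map g).functor)
        ((ArrCAT.Hom₂.bot ((D.comp toArr).mapComp f g).hom).app
          ((Prof.Hom.functor P).obj c))).symm)

variable {D} {X : CwA.{u}} {nu : WeightedCone W (D.comp toArr) X.arr}
  (h : ∀ j a, PreservesColimitsOfSize.{u, u} (legBot nu j a))

/-- The lower components of the legs of a limit cone of nerves form a limit of presheaf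
categories among all functors; it restricts to a limit among cocontinuous functors since
cocontinuity can be tested on the legs. -/
theorem isLimit_map_toProf_liftCone (hnu : nu.IsLimit) :
    ((liftCone nu h).map toProf).IsLimit := fun B => by
  have (j : J) : ((profTransform D B).functor j).Full := inferInstanceAs (profHom _ _).Full
  have (j : J) : ((profTransform D B).functor j).Faithful := inferInstanceAs (profHom _ _).Faithful
  refine (profTransform D B).isEquivalence_restriction hnu (profHom B X)
    (NatIso.ofComponents (fun P => WeightedCone.isoMk
      (fun j a => ArrCAT.ofBotIso (Functor.isoWhiskerLeft (Prof.Hom.functor P)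
        (ArrCAT.botIso (WeightedCone.isoApp (mapLiftCone nu h) j a))))
      (fun j {a b} t => ArrCAT.emptyTo_hom_ext fun c => ?_)
      (fun {i j} f a => ArrCAT.emptyTo_hom_ext fun c => ?_))
      (fun {P Q} β => WeightedCone.hom_ext fun j a => ArrCAT.emptyTo_hom_ext fun c => ?_))
    fun μ G ξ => ?_
  · exact congrArg (fun ξ => (ArrCAT.Hom₂.bot ξ).app ((Prof.Hom.functor P).obj c))
      ((WeightedCone.Hom.app (mapLiftCone nu h).hom j).naturality t)
  · have h₁ := congrArg (fun ξ => (ArrCAT.Hom₂.bot ξ).app ((Prof.Hom.functor P).obj c))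
      (WeightedCone.Hom.comm (mapLiftCone nu h).hom f a)
    exact (congrArg (· ≫ _) ((Category.id_comp _).trans (Category.id_comp _))).trans
      (h₁.trans (congrArg (_ ≫ ·) (Category.id_comp _).symm))
  · exact ((ArrCAT.Hom₂.bot (WeightedCone.isoApp (mapLiftCone nu h) j a).hom).naturality
      ((Prof.Hom₂.natTrans β).app c))
  · have hG : PreservesColimitsOfSize.{u, u} (ArrCAT.Hom.bot G) :=
      cocontinuous_of_comp_legBot hnu (B := B.carrier) _ fun j a => by
        have : PreservesColimitsOfSize.{u, u}
            (ArrCAT.Hom.bot ((((profTransform D B).mapConeObj μ).leg j).obj a)) :=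
          Prof.Hom.cocontinuous ((μ.leg j).obj a)
        exact preservesColimits_of_natIso (ArrCAT.botIso (WeightedCone.isoApp ξ j a)).symm
    exact ⟨⟨ArrCAT.Hom.bot G, hG⟩, ⟨ArrCAT.ofBotIso (Iso.refl _)⟩⟩

end Prof

section CAT

variable {J : Type u} [Bicategory.{u, u} J] {W : J ⥤ᵖ Cat.{u, u}} (D : J ⥤ᵖ CwA.{u})

/-- Functors into `E` as 1-cells of `CAT^2` into the nerve of `(A, E, I)`. -/
def catHom (C : Cat.{u, u + 1}) (Y : CwA.{u}) :
    (C ⟶ toCAT.obj Y) ⥤ (ArrCAT.idArr C ⟶ Y.arr) where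
  obj F := ArrCAT.ofTop (Y := Y.arr) F.toFunctor
  map α := ArrCAT.ofTop₂ (Y := Y.arr) (F := ArrCAT.ofTop _) (G := ArrCAT.ofTop _) α.toNatTrans
  map_id _ := ArrCAT.idArr_hom_ext fun _ => rfl
  map_comp _ _ := ArrCAT.idArr_hom_ext fun _ => rfl

instance (C : Cat.{u, u + 1}) (Y : CwA.{u}) : (catHom C Y).Faithful where
  map_injective {F G _ _} h := by
    ext c
    exact congrArg (fun ξ : ArrCAT.ofTop (Y := Y.arr) F.toFunctor ⟶
      ArrCAT.ofTop (Y := Y.arr) G.toFunctor => (ArrCAT.Hom₂.top ξ).app c) h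

instance (C : Cat.{u, u + 1}) (Y : CwA.{u}) : (catHom C Y).Full where
  map_surjective β := ⟨NatTrans.toCatHom₂ (ArrCAT.Hom₂.top β),
    ArrCAT.idArr_hom_ext fun _ => rfl⟩

instance (C : Cat.{u, u + 1}) (Y : CwA.{u}) : (catHom C Y).EssSurj where
  mem_essImage G := ⟨Functor.toCatHom (ArrCAT.Hom.top G), ⟨ArrCAT.ofTopIso (Iso.refl _)⟩⟩

/-- The equivalence between functors into the domain of an arrow and 1-cells of `CAT^2` out of an
identity arrow, for the nerves of a diagram. -/
noncomputable def catTransform (C : Cat.{u, u + 1}) :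
    HomTransform (D.comp toCAT) C (D.comp toArr) (ArrCAT.idArr C) where
  functor j := catHom C (D.obj j)
  square f F := ArrCAT.ofTopIso (Iso.refl _)
  square_natural f F G β := ArrCAT.idArr_hom_ext fun c =>
    (Category.comp_id _).trans (Category.id_comp _).symm
  square_map₂ {i j f g} θ F := ArrCAT.idArr_hom_ext fun c => by
    have h := congrArg (fun α => α.app (F.toFunctor.obj c)) (comp_toArr_map₂_top (D := D) θ)
    exact ((Category.comp_id _).trans h).trans (Category.id_comp _).symm
  square_id i F := ArrCAT.idArr_hom_ext fun c => by
    have h := congrArg (fun α => α.app (F.toFunctor.obj c)) (comp_toArr_mapId_hom_top (D := D) i)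
    exact (Category.id_comp _).trans ((Category.comp_id _).trans ((Category.comp_id _).trans
      (h.symm.trans (Category.comp_id _).symm)))
  square_comp f g F := ArrCAT.idArr_hom_ext fun c => by
    have h := congrArg (fun α => α.app (F.toFunctor.obj c))
      (comp_toArr_mapComp_hom_top (D := D) f g)
    exact (Category.id_comp _).trans ((Category.comp_id _).trans ((Category.comp_id _).trans
      (h.symm.trans (comp_id_map_id_comp_id (D.map g).functor _).symm)))

variable {D} {X : CwA.{u}} {nu : WeightedCone W (D.comp toArr) X.arr}
  (h : ∀ j a, PreservesColimitsOfSize.{u, u} (legBot nu j a))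

/-- Taking domains preserves limits, as it is represented by identity arrows. -/
theorem isLimit_map_toCAT_liftCone (hnu : nu.IsLimit) :
    ((liftCone nu h).map toCAT).IsLimit := fun C => by
  have (j : J) : ((catTransform D C).functor j).Full := inferInstanceAs (catHom _ _).Full
  have (j : J) : ((catTransform D C).functor j).Faithful := inferInstanceAs (catHom _ _).Faithful
  refine (catTransform D C).isEquivalence_restriction hnu (catHom C X)
    (NatIso.ofComponents (fun F => WeightedCone.isoMk
      (fun j a => ArrCAT.ofTopIso (Iso.refl _))
      (fun j {a b} t => ArrCAT.idArr_hom_ext fun c => ?_)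
      (fun {i j} f a => ArrCAT.idArr_hom_ext fun c => ?_))
      (fun {F G} β => WeightedCone.hom_ext fun j a => ArrCAT.idArr_hom_ext fun c => ?_))
    fun μ G ξ => Functor.EssSurj.mem_essImage (F := catHom C X) G
  · exact (Category.comp_id _).trans (Category.id_comp _).symm
  · refine (Category.comp_id _).trans ((Category.id_comp _).trans ((Category.id_comp _).trans
      ((Category.id_comp _).trans ?_)))
    refine Eq.trans ?_ (congrArg (· ≫ _) ((D.map f).functor.map_id _).symm)
    exact ((Category.id_comp _).trans (Category.id_comp _)).symm
  · exact (Category.comp_id _).trans (Category.id_comp _).symm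

end CAT

end CwA

end Arities

theorem mainTheorem2 {J : Type u} [Bicategory.{u, u} J]
    (W : J ⥤ᵖ Cat.{u, u}) (D : J ⥤ᵖ Arities.CwA.{u})
    (A : Arities.Prof.{u})
    (lam : WeightedLimits.WeightedCone W (D.comp Arities.CwA.toProf) A) (hlam : lam.IsLimit)
    (E : Type (u + 1)) [LargeCategory.{u} E]
    (I : A.carrier ⥤ E) [I.Full] [I.Faithful]
    (nu : WeightedLimits.WeightedCone W (D.comp Arities.CwA.toArr)
      (Arities.ArrCAT.mk E (Arities.Psh A.carrier) (Arities.nerve I)))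
    (hnu : nu.IsLimit) :
    ∃ (_ : I.IsDense) (kap : WeightedLimits.WeightedCone W D (Arities.CwA.mk A.carrier E I)),
      kap.IsLimit ∧
      Nonempty (kap.map Arities.CwA.toArr ≅ nu) ∧
      (kap.map Arities.CwA.toProf).IsLimit ∧
      (kap.map Arities.CwA.toCAT).IsLimit := by
  have hI : I.IsDense := Arities.isDense_of_isLimit I hnu
  have h := Arities.CwA.legBot_cocontinuous hnu
  let X := Arities.CwA.mk A.carrier E I
  exact ⟨hI, Arities.CwA.liftCone (X := X) nu h,
    Arities.CwA.isLimit_liftCone h hnu, ⟨Arities.CwA.mapLiftCone (X := X) nu h⟩,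
    Arities.CwA.isLimit_map_toProf_liftCone h hnu, Arities.CwA.isLimit_map_toCAT_liftCone h hnu⟩
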